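/- Conventions. Let $A$ be a (complex, not necessarily unital) C*-algebra, $G$ a discrete group and $\alpha\colon G\to\mathrm{Aut}(A)$ an action. Put $A_\infty=\ell^\infty(\mathbb N,A)/c_0(\mathbb N,A)$ and regard $A$ as a subalgebra of $A_\infty$ through constant sequences. For a C*-subalgebra $D\subset A$ let $$A_\infty\cap D'=\{x\in A_\infty: xd=dx\ \text{for all } d\in D\},\qquad \mathrm{Ann}(D,A_\infty)=\{x\in A_\infty: xd=dx=0\ \text{for all } d\in D\},$$ and let $F(D,A)=(A_\infty\cap D')/\mathrm{Ann}(D,A_\infty)$ be Kirchberg's central sequence algebra, which is unital when $D$ is separable. If $D$ is $\alpha$-invariant, then applying $\alpha_g$ to each term of a sequence induces an action $\widetilde\alpha_\infty$ of $G$ on $F(D,A)$. If $G$ acts by homeomorphisms on a compact Hausdorff space $X$, then $G$ acts on $C(X)$ by $(g\cdot f)(x)=f(g^{-1}x)$; this action is denoted $\sigma^H$ for $X=G/H$ with left translation, where $H\le G$ is a subgroup of finite index, and $\sigma$ for $X=\overline G$, the profinite completion $\varprojlim G/N$ over the normal subgroups $N$ of finite index, with left translation. Elements $a,b$ of a C*-algebra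 are orthogonal if $ab=ba=a^*b=b^*a=0$; a contractive completely positive (c.c.p.) map $\varphi$ has order zero if it maps orthogonal elements to orthogonal elements. For a subgroup $H\le G$ of finite index, $\dim_{\mathrm{Rok}}(\alpha,H)\in\{0,1,2,\dots,\infty\}$ is the least integer $d\ge 0$ such that for every separable $\alpha$-invariant C*-subalgebra $D\subset A$ there are $d+1$ equivariant c.c.p. order zero maps $\varphi_0,\dots,\varphi_d\colon (C(G/H),\sigma^H)\to(F(D,A),\widetilde\alpha_\infty)$ with $\sum_{\ell=0}^d\varphi_\ell(1)=1_{F(D,A)}$, and it is $\infty$ if there is no such $d$. The Rokhlin dimension of $\alpha$ is $\dim_{\mathrm{Rok}}(\alpha)=\sup_H\dim_{\mathrm{Rok}}(\alpha,H)$, the supremum over all subgroups $H$ of finite index. Theorem. Let $A$ be a C*-algebra, $G$ a finitely generated, residually finite discrete group, $\alpha\colon G\to\mathrm{Aut}(A)$ an action, and $d\ge 0$ an integer. Then $\dim_{\mathrm{Rok}}(\alpha)\le d$ if and only if for every separable $\alpha$-invariant C*-subalgebra $D\subset A$ there are $d+1$ equivariant c.c.p. order zero maps $$\varphi_0,\dots,\varphi_d\colon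 (C(\overline G),\sigma)\to(F(D,A),\widetilde\alpha_\infty)\quad\text{with}\quad \sum_{\ell=0}^d\varphi_\ell(1_{C(\overline G)})=1_{F(D,A)}.$$ -/

import Mathlib

open scoped ENNReal ComplexOrder CStarAlgebra

universe u v

noncomputable section

/-! ### Quotients of C*-algebras -/

/-- A closed two-sided self-adjoint ideal of a C*-algebra. -/
structure ClosedStarIdeal (B : Type*) [NonUnitalCStarAlgebra B] extends Submodule ℂ B where
  isClosed' : IsClosed (carrier : Set B)
  mul_mem_left' : ∀ (b : B) {x : B}, x ∈ carrier → b * x ∈ carrier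
  mul_mem_right' : ∀ (b : B) {x : B}, x ∈ carrier → x * b ∈ carrier
  star_mem' : ∀ {x : B}, x ∈ carrier → star x ∈ carrier

namespace ClosedStarIdeal

variable {B : Type*} [NonUnitalCStarAlgebra B] (I : ClosedStarIdeal B)

instance : IsClosed (I.toSubmodule : Set B) := I.isClosed'

/-- The ideal as a C*-subalgebra. -/
def toSub : NonUnitalStarSubalgebra ℂ B where
  __ := I.toSubmodule
  mul_mem' _ hb := I.mul_mem_left' _ hb
  star_mem' := I.star_mem'

instance : IsClosed (I.toSub : Set B) := I.isClosed'

/-- The quotient C*-algebra `B / I`, with the quotient norm. -/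
def Quotient : Type _ := B ⧸ I.toSubmodule

instance : NormedAddCommGroup I.Quotient :=
  inferInstanceAs (NormedAddCommGroup (B ⧸ I.toSubmodule))

instance : NormedSpace ℂ I.Quotient :=
  inferInstanceAs (NormedSpace ℂ (B ⧸ I.toSubmodule))

instance : CompleteSpace I.Quotient :=
  inferInstanceAs (CompleteSpace (B ⧸ I.toSubmodule))

/-- The quotient map as a linear map. -/
def mkₗ : B →ₗ[ℂ] I.Quotient := I.toSubmodule.mkQ

theorem mkₗ_surjective : Function.Surjective I.mkₗ := I.toSubmodule.mkQ_surjective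

theorem mkₗ_eq_iff {x y : B} : I.mkₗ x = I.mkₗ y ↔ x - y ∈ I.toSubmodule :=
  Submodule.Quotient.eq I.toSubmodule

theorem norm_mkₗ_le (x : B) : ‖I.mkₗ x‖ ≤ ‖x‖ := Submodule.Quotient.norm_mk_le I.toSubmodule x

theorem exists_norm_lt (q : I.Quotient) {ε : ℝ} (hε : 0 < ε) :
    ∃ b, I.mkₗ b = q ∧ ‖b‖ < ‖q‖ + ε :=
  Submodule.Quotient.norm_mk_lt (S := I.toSubmodule) q hε

instance : Mul I.Quotient where
  mul := _root_.Quotient.map₂ (· * ·) (by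
    intro a a' ha b b' hb
    have ha' := (Submodule.quotientRel_def I.toSubmodule).mp ha
    have hb' := (Submodule.quotientRel_def I.toSubmodule).mp hb
    refine (Submodule.quotientRel_def I.toSubmodule).mpr ?_
    have : a * b - a' * b' = a * (b - b') + (a - a') * b' := by
      rw [mul_sub, sub_mul]; abel
    rw [this]
    exact I.toSubmodule.add_mem (I.mul_mem_left' _ hb') (I.mul_mem_right' _ ha'))

theorem mkₗ_mul (a b : B) : I.mkₗ (a * b) = I.mkₗ a * I.mkₗ b := rfl

instance : Star I.Quotient where
  star := _root_.Quotient.map star (by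
    intro a a' ha
    have ha' := (Submodule.quotientRel_def I.toSubmodule).mp ha
    refine (Submodule.quotientRel_def I.toSubmodule).mpr ?_
    rw [← star_sub]
    exact I.star_mem' ha')

theorem mkₗ_star (a : B) : I.mkₗ (star a) = star (I.mkₗ a) := rfl

theorem induction {p : I.Quotient → Prop} (h : ∀ b, p (I.mkₗ b)) (q : I.Quotient) : p q := by
  obtain ⟨b, rfl⟩ := I.mkₗ_surjective q
  exact h b

instance : NonUnitalNormedRing I.Quotient where
  __ := (inferInstance : NormedAddCommGroup I.Quotient)
  left_distrib a b c := by
    induction a using I.induction with | _ a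
    induction b using I.induction with | _ b
    induction c using I.induction with | _ c
    simp only [← map_add, ← mkₗ_mul, mul_add]
  right_distrib a b c := by
    induction a using I.induction with | _ a
    induction b using I.induction with | _ b
    induction c using I.induction with | _ c
    simp only [← map_add, ← mkₗ_mul, add_mul]
  zero_mul a := by
    induction a using I.induction with | _ a
    rw [← map_zero I.mkₗ, ← mkₗ_mul, zero_mul]
  mul_zero a := by
    induction a using I.induction with | _ a
    rw [← map_zero I.mkₗ, ← mkₗ_mul, mul_zero]
  mul_assoc a b c := by
    induction a using I.induction with | _ a
    induction b using I.induction with | _ b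
    induction c using I.induction with | _ c
    simp only [← mkₗ_mul, mul_assoc]
  norm_mul_le a b := by
    have key : ∀ ε > 0, ‖a * b‖ ≤ (‖a‖ + ε) * (‖b‖ + ε) := by
      intro ε hε
      obtain ⟨x, rfl, hx⟩ := I.exists_norm_lt a hε
      obtain ⟨y, rfl, hy⟩ := I.exists_norm_lt b hε
      rw [← mkₗ_mul]
      calc ‖I.mkₗ (x * y)‖ ≤ ‖x * y‖ := I.norm_mkₗ_le _
        _ ≤ ‖x‖ * ‖y‖ := norm_mul_le _ _
        _ ≤ _ := by gcongr
    have hlim : Filter.Tendsto (fun ε : ℝ => (‖a‖ + ε) * (‖b‖ + ε))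
        (nhdsWithin 0 (Set.Ioi 0)) (nhds (‖a‖ * ‖b‖)) := by
      have : Continuous (fun ε : ℝ => (‖a‖ + ε) * (‖b‖ + ε)) := by fun_prop
      have h := this.tendsto 0
      simp only [add_zero] at h
      exact h.mono_left nhdsWithin_le_nhds
    exact ge_of_tendsto hlim (by filter_upwards [self_mem_nhdsWithin] with ε hε using key ε hε)

instance : StarRing I.Quotient where
  star_involutive a := by
    induction a using I.induction with | _ a
    rw [← mkₗ_star, ← mkₗ_star, star_star]
  star_mul a b := by
    induction a using I.induction with | _ a
    induction b using I.induction with | _ b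
    simp only [← mkₗ_mul, ← mkₗ_star, star_mul]
  star_add a b := by
    induction a using I.induction with | _ a
    induction b using I.induction with | _ b
    simp only [← map_add, ← mkₗ_star, star_add]

/-- Elements of the ideal are approximately fixed by a suitable self-adjoint `e` of the ideal
for which `1 - e` is a contraction of the unitization. -/
theorem exists_approx {x : B} (hx : x ∈ I.toSubmodule) {ε : ℝ} (hε : 0 < ε) :
    ∃ e ∈ I.toSubmodule, star e = e ∧ ‖(1 - (e : Unitization ℂ B))‖ ≤ 1 ∧ ‖x - x * e‖ < ε := by
  let _ : PartialOrder I.toSub := CStarAlgebra.spectralOrder _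
  let _ : StarOrderedRing I.toSub := CStarAlgebra.spectralOrderedRing _
  let _ : PartialOrder B := CStarAlgebra.spectralOrder _
  let _ : StarOrderedRing B := CStarAlgebra.spectralOrderedRing _
  have hA := CStarAlgebra.increasingApproximateUnit I.toSub
  have h1 := hA.tendsto_mul_left ⟨x, hx⟩
  have h2 := (Metric.tendsto_nhds.mp h1) ε hε
  have h3 := hA.eventually_nonneg
  have h4 := hA.eventually_norm
  obtain ⟨e, he1, he2, he3⟩ := (h2.and (h3.and h4)).exists
  have hpos : (0 : B) ≤ (e : B) := by
    obtain ⟨c, hc⟩ := CStarAlgebra.nonneg_iff_eq_star_mul_self.mp he2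
    rw [hc]
    exact star_mul_self_nonneg (c : B)
  refine ⟨e, e.2, (IsSelfAdjoint.of_nonneg hpos).star_eq, ?_, ?_⟩
  · have hpos' : (0 : Unitization ℂ B) ≤ (e : B) := by
      rwa [Unitization.inr_nonneg_iff]
    have hle : ((e : B) : Unitization ℂ B) ≤ 1 := by
      apply (CStarAlgebra.norm_le_one_iff_of_nonneg _ hpos').mp
      rw [Unitization.norm_inr]; exact he3
    rw [CStarAlgebra.norm_le_one_iff_of_nonneg _ (sub_nonneg.mpr hle)]
    exact sub_le_self _ hpos'
  · rw [dist_comm, dist_eq_norm] at he1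
    exact he1

instance : CStarRing I.Quotient where
  norm_mul_self_le a := by
    induction a using I.induction with | _ b
    rw [← mkₗ_star, ← mkₗ_mul]
    refine le_of_forall_pos_le_add fun ε hε => ?_
    obtain ⟨y, hy, hy'⟩ := I.exists_norm_lt (I.mkₗ (star b * b)) (half_pos hε)
    rw [mkₗ_eq_iff] at hy
    obtain ⟨e, he, hes, he1, hex⟩ := I.exists_approx hy (half_pos hε)
    have hq : I.mkₗ b = I.mkₗ (b - b * e) := by
      rw [mkₗ_eq_iff]
      simpa using I.mul_mem_left' b he
    set E : Unitization ℂ B := 1 - (e : Unitization ℂ B) with hE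
    have hEs : star E = E := by
      rw [hE, star_sub, star_one, ← Unitization.inr_star, hes]
    have hb : ((b - b * e : B) : Unitization ℂ B) = b * E := by
      rw [hE, mul_sub, mul_one, Unitization.inr_sub, Unitization.inr_mul]
    have hn : ‖I.mkₗ b‖ ≤ ‖(b : Unitization ℂ B) * E‖ := by
      rw [hq, ← hb, Unitization.norm_inr]; exact I.norm_mkₗ_le _
    have hx : ‖((y - star b * b : B) : Unitization ℂ B) * E‖ < ε / 2 := by
      rw [hE, mul_sub, mul_one, ← Unitization.inr_mul, ← Unitization.inr_sub,
        Unitization.norm_inr]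
      exact hex
    calc ‖I.mkₗ b‖ * ‖I.mkₗ b‖ ≤ ‖(b : Unitization ℂ B) * E‖ * ‖(b : Unitization ℂ B) * E‖ := by
          gcongr
      _ = ‖star ((b : Unitization ℂ B) * E) * ((b : Unitization ℂ B) * E)‖ :=
          CStarRing.norm_star_mul_self.symm
      _ = ‖E * (y : Unitization ℂ B) * E
            - E * (((y - star b * b : B) : Unitization ℂ B) * E)‖ := by
          congr 1
          rw [star_mul, hEs, Unitization.inr_sub, Unitization.inr_mul, Unitization.inr_star]
          noncomm_ring
      _ ≤ ‖E * (y : Unitization ℂ B) * E‖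
            + ‖E * (((y - star b * b : B) : Unitization ℂ B) * E)‖ := norm_sub_le _ _
      _ ≤ 1 * ‖(y : Unitization ℂ B)‖ * 1 + 1 * (ε / 2) := by
          gcongr
          · exact (norm_mul_le _ _).trans (by gcongr; exact (norm_mul_le _ _).trans (by gcongr))
          · exact (norm_mul_le _ _).trans (by gcongr)
      _ = ‖y‖ + ε / 2 := by rw [Unitization.norm_inr]; ring
      _ ≤ _ := by linarith

instance : NonUnitalCStarAlgebra I.Quotient where
  smul_assoc r a b := by
    induction a using I.induction with | _ a
    induction b using I.induction with | _ b
    simp only [smul_eq_mul, ← map_smul, ← mkₗ_mul, smul_mul_assoc]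
  smul_comm r a b := by
    induction a using I.induction with | _ a
    induction b using I.induction with | _ b
    simp only [smul_eq_mul, ← map_smul, ← mkₗ_mul, mul_smul_comm]
  star_smul r a := by
    induction a using I.induction with | _ a
    simp only [← map_smul, ← mkₗ_star, star_smul]

/-- The C*-algebraic order: positive elements are those of the form `star x * x`. -/
instance : PartialOrder I.Quotient := CStarAlgebra.spectralOrder _

instance : StarOrderedRing I.Quotient := CStarAlgebra.spectralOrderedRing _

/-- The quotient *-homomorphism `B → B / I`. -/
def proj : B →⋆ₙₐ[ℂ] I.Quotient where
  __ := I.mkₗ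
  map_zero' := map_zero I.mkₗ
  map_mul' := I.mkₗ_mul
  map_star' := I.mkₗ_star

theorem proj_eq_iff {x y : B} : I.proj x = I.proj y ↔ x - y ∈ I.toSubmodule := I.mkₗ_eq_iff

theorem proj_surjective : Function.Surjective I.proj := I.mkₗ_surjective

/-- The *-homomorphism `B / I → C / J` induced by a *-homomorphism `f : B → C` with
`f(I) ⊆ J`. -/
def map {C : Type*} [NonUnitalCStarAlgebra C] (J : ClosedStarIdeal C) (f : B →⋆ₙₐ[ℂ] C)
    (hf : ∀ x ∈ I.toSubmodule, f x ∈ J.toSubmodule) : I.Quotient →⋆ₙₐ[ℂ] J.Quotient where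
  toFun := I.toSubmodule.mapQ J.toSubmodule (f : B →ₗ[ℂ] C) hf
  map_smul' := map_smul (I.toSubmodule.mapQ J.toSubmodule (f : B →ₗ[ℂ] C) hf)
  map_zero' := map_zero (I.toSubmodule.mapQ J.toSubmodule (f : B →ₗ[ℂ] C) hf)
  map_add' := map_add (I.toSubmodule.mapQ J.toSubmodule (f : B →ₗ[ℂ] C) hf)
  map_mul' a b := by
    induction a using I.induction with | _ a
    induction b using I.induction with | _ b
    exact congrArg J.mkₗ (map_mul f a b)
  map_star' a := by
    induction a using I.induction with | _ a
    exact congrArg J.mkₗ (map_star f a)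

theorem map_proj {C : Type*} [NonUnitalCStarAlgebra C] (J : ClosedStarIdeal C) (f : B →⋆ₙₐ[ℂ] C)
    (hf : ∀ x ∈ I.toSubmodule, f x ∈ J.toSubmodule) (b : B) :
    I.map J f hf (I.proj b) = J.proj (f b) := rfl

end ClosedStarIdeal

/-! ### The sequence algebra `A_∞ = ℓ^∞(ℕ, A) / c₀(ℕ, A)` -/

section SequenceAlgebra

variable (A : Type v) [NonUnitalCStarAlgebra A]

/-- `ℓ^∞(ℕ, A)`. -/
abbrev BddSeq : Type v := lp (fun _ : ℕ => A) ∞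

/-- The ideal `c₀(ℕ, A)` of `ℓ^∞(ℕ, A)`. -/
def c0Ideal : ClosedStarIdeal (BddSeq A) where
  carrier := {x | Filter.Tendsto (fun n => x n) Filter.atTop (nhds 0)}
  add_mem' {x y} hx hy := by simpa using Filter.Tendsto.add hx hy
  zero_mem' := by simp
  smul_mem' c x hx := by simpa using Filter.Tendsto.const_smul hx c
  isClosed' := by
    refine isClosed_of_closure_subset fun x hx => ?_
    rw [Metric.mem_closure_iff] at hx
    rw [Set.mem_ofPred_eq, Metric.tendsto_atTop]
    intro ε hε
    obtain ⟨y, hy, hxy⟩ := hx (ε / 2) (half_pos hε)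
    obtain ⟨N, hN⟩ := (Metric.tendsto_atTop.mp hy) (ε / 2) (half_pos hε)
    refine ⟨N, fun n hn => ?_⟩
    have h1 : dist (x n) (y n) ≤ dist x y := by
      rw [dist_eq_norm, dist_eq_norm]
      exact lp.norm_apply_le_norm (by simp) (x - y) n
    have := dist_triangle (x n) (y n) 0
    linarith [hN n hn]
  mul_mem_left' b x hx := by
    have hb : Filter.IsBoundedUnder (· ≤ ·) Filter.atTop (norm ∘ fun n => b n) :=
      Filter.isBoundedUnder_of ⟨‖b‖, fun n => lp.norm_apply_le_norm (by simp) b n⟩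
    simpa using Filter.isBoundedUnder_le_mul_tendsto_zero hb hx
  mul_mem_right' b x hx := by
    have hb : Filter.IsBoundedUnder (· ≤ ·) Filter.atTop (norm ∘ fun n => b n) :=
      Filter.isBoundedUnder_of ⟨‖b‖, fun n => lp.norm_apply_le_norm (by simp) b n⟩
    simpa using Filter.Tendsto.zero_mul_isBoundedUnder_le hx hb
  star_mem' {x} hx := by simpa using Filter.Tendsto.star hx

/-- The sequence algebra `A_∞`. -/
abbrev SeqAlg : Type v := (c0Ideal A).Quotient

variable {A}

/-- The constant sequence. -/
def constSeq (a : A) : BddSeq A :=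
  ⟨fun _ => a, memℓp_infty ⟨‖a‖, by rintro _ ⟨i, rfl⟩; exact le_rfl⟩⟩

/-- The canonical embedding of `A` into `A_∞` by constant sequences. -/
def SeqAlg.const : A →⋆ₙₐ[ℂ] SeqAlg A where
  toFun a := (c0Ideal A).proj (constSeq a)
  map_smul' c a := map_smul (c0Ideal A).proj c (constSeq a)
  map_zero' := map_zero (c0Ideal A).proj
  map_add' a b := map_add (c0Ideal A).proj (constSeq a) (constSeq b)
  map_mul' a b := map_mul (c0Ideal A).proj (constSeq a) (constSeq b)
  map_star' a := map_star (c0Ideal A).proj (constSeq a)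

/-- Coordinatewise application of a *-homomorphism to bounded sequences. -/
def BddSeq.map (f : A →⋆ₙₐ[ℂ] A) : BddSeq A →⋆ₙₐ[ℂ] BddSeq A where
  toFun x := ⟨fun n => f (x n), memℓp_infty ⟨‖x‖, by
    rintro _ ⟨i, rfl⟩
    exact (NonUnitalStarAlgHom.norm_apply_le f (x i)).trans
      (lp.norm_apply_le_norm (by simp) x i)⟩⟩
  map_smul' c x := by ext n; simp
  map_zero' := by ext n; simp
  map_add' x y := by ext n; exact map_add f (x n) (y n)
  map_mul' x y := by ext n; exact map_mul f (x n) (y n)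
  map_star' x := by ext n; exact map_star f (x n)

/-- The endomorphism of `A_∞` induced by a *-homomorphism of `A`. -/
def SeqAlg.map (f : A →⋆ₙₐ[ℂ] A) : SeqAlg A →⋆ₙₐ[ℂ] SeqAlg A :=
  (c0Ideal A).map (c0Ideal A) (BddSeq.map f) fun x hx => by
    have h := ((map_continuous f).tendsto 0).comp (show Filter.Tendsto _ _ _ from hx)
    rw [map_zero] at h
    exact h

theorem SeqAlg.map_const (f : A →⋆ₙₐ[ℂ] A) (a : A) :
    SeqAlg.map f (SeqAlg.const a) = SeqAlg.const (f a) := rfl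

/-! ### The central sequence algebra `F(D, A)` -/

variable (D : NonUnitalStarSubalgebra ℂ A)

/-- The relative commutant `A_∞ ∩ D'`. -/
def relCommutant : NonUnitalStarSubalgebra ℂ (SeqAlg A) where
  carrier := {x | ∀ d ∈ D, x * SeqAlg.const d = SeqAlg.const d * x}
  add_mem' hx hy d hd := by rw [add_mul, mul_add, hx d hd, hy d hd]
  zero_mem' d _ := by rw [zero_mul, mul_zero]
  mul_mem' {x y} hx hy d hd := by
    rw [mul_assoc, hy d hd, ← mul_assoc, hx d hd, mul_assoc]
  smul_mem' c x hx d hd := by rw [smul_mul_assoc, mul_smul_comm, hx d hd]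
  star_mem' {x} hx d hd := by
    have h := congrArg star (hx (star d) (star_mem hd))
    simp only [star_mul, map_star, star_star] at h
    exact h.symm

instance : IsClosed (relCommutant D : Set (SeqAlg A)) := by
  have : (relCommutant D : Set (SeqAlg A)) =
      ⋂ d ∈ D, {x | x * SeqAlg.const d = SeqAlg.const d * x} := by
    ext x
    simp only [Set.mem_iInter, Set.mem_ofPred_eq]
    exact Iff.rfl
  rw [this]
  exact isClosed_biInter fun d _ => isClosed_eq (by fun_prop) (by fun_prop)

/-- The annihilator `Ann(D, A_∞)`, as an ideal of `A_∞ ∩ D'`. -/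
def annIdeal : ClosedStarIdeal (relCommutant D) where
  carrier := {x | ∀ d ∈ D, (x : SeqAlg A) * SeqAlg.const d = 0 ∧
    SeqAlg.const d * (x : SeqAlg A) = 0}
  add_mem' {x y} hx hy d hd := by
    simp [add_mul, mul_add, (hx d hd).1, (hx d hd).2, (hy d hd).1, (hy d hd).2]
  zero_mem' d _ := by simp
  smul_mem' c x hx d hd := by
    simp [smul_mul_assoc, mul_smul_comm, (hx d hd).1, (hx d hd).2]
  isClosed' := by
    have : {x : relCommutant D | ∀ d ∈ D, (x : SeqAlg A) * SeqAlg.const d = 0 ∧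
        SeqAlg.const d * (x : SeqAlg A) = 0} =
        ⋂ d ∈ D, ({x : relCommutant D | (x : SeqAlg A) * SeqAlg.const d = 0} ∩
          {x : relCommutant D | SeqAlg.const d * (x : SeqAlg A) = 0}) := by
      ext x; simp
    change IsClosed {x : relCommutant D | ∀ d ∈ D, (x : SeqAlg A) * SeqAlg.const d = 0 ∧
        SeqAlg.const d * (x : SeqAlg A) = 0}
    rw [this]
    exact isClosed_biInter fun d _ =>
      (isClosed_eq (by fun_prop) (by fun_prop)).inter (isClosed_eq (by fun_prop) (by fun_prop))
  mul_mem_left' b x hx d hd := by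
    refine ⟨?_, ?_⟩
    · change (b : SeqAlg A) * x * _ = 0
      rw [mul_assoc, (hx d hd).1, mul_zero]
    · change _ * ((b : SeqAlg A) * x) = 0
      rw [← mul_assoc, ← b.2 d hd, mul_assoc, (hx d hd).2, mul_zero]
  mul_mem_right' b x hx d hd := by
    refine ⟨?_, ?_⟩
    · change (x : SeqAlg A) * b * _ = 0
      rw [mul_assoc, b.2 d hd, ← mul_assoc, (hx d hd).1, zero_mul]
    · change _ * ((x : SeqAlg A) * b) = 0
      rw [← mul_assoc, (hx d hd).2, zero_mul]
  star_mem' {x} hx d hd := by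
    have h := hx (star d) (star_mem hd)
    have h1 := congrArg star h.1
    have h2 := congrArg star h.2
    simp only [star_mul, map_star, star_star, star_zero] at h1 h2
    exact ⟨h2, h1⟩

/-- Kirchberg's central sequence algebra `F(D, A) = (A_∞ ∩ D') / Ann(D, A_∞)`. -/
abbrev CentralSeqAlg : Type v := (annIdeal D).Quotient

end SequenceAlgebra

/-! ### The induced action on `F(D, A)` -/

section Action

variable {G : Type u} [Group G] {A : Type v} [NonUnitalCStarAlgebra A]
  (α : G →* (A ≃⋆ₐ[ℂ] A))

/-- `D` is an `α`-invariant subalgebra. -/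
def IsInvariantSub (D : NonUnitalStarSubalgebra ℂ A) : Prop :=
  ∀ g : G, ∀ a ∈ D, α g a ∈ D

/-- The automorphism `α_∞(g)` of `A_∞`, induced by applying `α g` coordinatewise. -/
def seqAction (g : G) : SeqAlg A →⋆ₙₐ[ℂ] SeqAlg A := SeqAlg.map (α g : A →⋆ₙₐ[ℂ] A)

theorem seqAction_const (g : G) (a : A) :
    seqAction α g (SeqAlg.const a) = SeqAlg.const (α g a) := rfl

variable {α} {D : NonUnitalStarSubalgebra ℂ A}

theorem const_eq_seqAction (g : G) (d : A) :
    SeqAlg.const d = seqAction α g (SeqAlg.const (α g⁻¹ d)) := by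
  rw [seqAction_const]
  congr 1
  rw [← StarAlgEquiv.mul_apply, ← map_mul, mul_inv_cancel, map_one, StarAlgEquiv.one_apply]

/-- The restriction of `α_∞(g)` to `A_∞ ∩ D'`. -/
def commutantAction (hD : IsInvariantSub α D) (g : G) :
    relCommutant D →⋆ₙₐ[ℂ] relCommutant D :=
  NonUnitalStarAlgHom.codRestrict
    ((seqAction α g).comp (NonUnitalStarSubalgebraClass.subtype (relCommutant D)))
    (relCommutant D) (by
      intro x d hd
      change seqAction α g (x : SeqAlg A) * _ = _ * seqAction α g (x : SeqAlg A)
      rw [const_eq_seqAction (α := α) g d, ← map_mul, ← map_mul, x.2 _ (hD g⁻¹ d hd)])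

/-- The induced action of `G` on `F(D, A)`. -/
def centralAction (hD : IsInvariantSub α D) (g : G) :
    CentralSeqAlg D →⋆ₙₐ[ℂ] CentralSeqAlg D :=
  (annIdeal D).map (annIdeal D) (commutantAction hD g) (by
    intro x hx d hd
    have h := hx _ (hD g⁻¹ d hd)
    change seqAction α g (x : SeqAlg A) * _ = 0 ∧ _ * seqAction α g (x : SeqAlg A) = 0
    rw [const_eq_seqAction (α := α) g d, ← map_mul, ← map_mul, h.1, h.2, map_zero]
    exact ⟨rfl, rfl⟩)

end Action

/-! ### Order zero maps and Rokhlin dimension -/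

/-- Orthogonality of two elements of a C*-algebra. -/
def Orthog {B : Type*} [NonUnitalNonAssocRing B] [Star B] (a b : B) : Prop :=
  a * b = 0 ∧ b * a = 0 ∧ star a * b = 0 ∧ star b * a = 0

/-- `e` is the unit `1_B` of the (a priori not necessarily unital) algebra `B`. -/
def IsUnitOf {B : Type*} [Mul B] (e : B) : Prop := ∀ b : B, e * b = b ∧ b * e = b

section Rokhlin

variable {G : Type u} [Group G] {A : Type v} [NonUnitalCStarAlgebra A]

/-- The translation action of `G` on `C(X)`, `(σ_g f)(x) = f(g⁻¹ x)`. -/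
def translateFun {X : Type*} [TopologicalSpace X] [MulAction G X] [ContinuousConstSMul G X]
    (g : G) (f : C(X, ℂ)) : C(X, ℂ) :=
  f.comp ⟨fun x => g⁻¹ • x, continuous_const_smul g⁻¹⟩

/-- A contractive completely positive map `φ` that has order zero and is equivariant from
`(C(X), σ)` to `F(D, A)` with its induced action. -/
structure IsEquivariantOrderZeroCCP {X : Type*} [TopologicalSpace X] [CompactSpace X]
    [MulAction G X] [ContinuousConstSMul G X] {α : G →* (A ≃⋆ₐ[ℂ] A)}
    {D : NonUnitalStarSubalgebra ℂ A} (hD : IsInvariantSub α D)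
    (φ : C(X, ℂ) →CP CentralSeqAlg D) : Prop where
  contractive : ∀ f, ‖φ f‖ ≤ ‖f‖
  orderZero : ∀ f₁ f₂, Orthog f₁ f₂ → Orthog (φ f₁) (φ f₂)
  equivariant : ∀ g f, φ (translateFun g f) = centralAction hD g (φ f)

variable [TopologicalSpace G] [DiscreteTopology G]

/-- For every separable `α`-invariant C*-subalgebra `D` of `A` there are `d + 1` equivariant c.c.p.
order zero maps `C(G/H) → F(D, A)` whose values at `1` sum to the unit. -/
def HasRokhlinMaps (α : G →* (A ≃⋆ₐ[ℂ] A)) (H : Subgroup G) [H.FiniteIndex] (d : ℕ) : Prop :=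
  ∀ (D : NonUnitalStarSubalgebra ℂ A) (hD : IsInvariantSub α D), IsClosed (D : Set A) →
    TopologicalSpace.IsSeparable (D : Set A) →
    ∃ φ : Fin (d + 1) → (C(G ⧸ H, ℂ) →CP CentralSeqAlg D),
      (∀ l, IsEquivariantOrderZeroCCP hD (φ l)) ∧ IsUnitOf (∑ l, φ l 1)

/-- The Rokhlin dimension `dim_Rok(α, H)` relative to a subgroup of finite index: the least `d`
with `HasRokhlinMaps α H d`, and `∞` if there is none. -/
def rokhlinDimRel (α : G →* (A ≃⋆ₐ[ℂ] A)) (H : Subgroup G) [H.FiniteIndex] : ℕ∞ :=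
  ⨅ (d : ℕ) (_ : HasRokhlinMaps α H d), (d : ℕ∞)

/-- The Rokhlin dimension `dim_Rok(α)`. -/
def rokhlinDim (α : G →* (A ≃⋆ₐ[ℂ] A)) : ℕ∞ :=
  ⨆ (H : Subgroup G) (_ : H.FiniteIndex), rokhlinDimRel α H

end Rokhlin

/-! ### The profinite completion with its translation action -/

/-- The profinite completion of `G`. -/
abbrev ProfCompletion (G : Type u) [Group G] : Type u :=
  ProfiniteGrp.ProfiniteCompletion.completion (GrpCat.of G)

/-- The canonical homomorphism from `G` to its profinite completion. -/
def toProfCompletion (G : Type u) [Group G] : G →* ProfCompletion G :=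
  (ProfiniteGrp.ProfiniteCompletion.eta (GrpCat.of G)).hom

/-- The left translation action of `G` on its profinite completion. -/
instance (G : Type u) [Group G] : MulAction G (ProfCompletion G) where
  smul g x := toProfCompletion G g * x
  one_smul x := by
    change toProfCompletion G 1 * x = x
    rw [map_one, one_mul]
  mul_smul g h x := by
    change toProfCompletion G (g * h) * x = toProfCompletion G g * (toProfCompletion G h * x)
    rw [map_mul, mul_assoc]

instance (G : Type u) [Group G] : ContinuousConstSMul G (ProfCompletion G) where
  continuous_const_smul g := by
    change Continuous fun x => toProfCompletion G g * x
    fun_prop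

end

/-! The converse direction is a pullback: the profinite completion maps equivariantly onto `G ⧸ H`
through the quotient by the normal core of `H`, so maps on `C(ProfCompletion G, ℂ)` restrict to maps
on `C(G ⧸ H, ℂ)` with the same value at 1 (`exists_equivariantOrderZero_comp`).

For the forward direction, finite generation gives a decreasing cofinal sequence `N n` of normal
subgroups of finite index, so the completion is the inverse limit of the finite quotients `G ⧸ N n`.
Each quotient carries Rokhlin maps, but the maps for different `n` need not be compatible, so they
do not pass directly to a limit. They are instead approximated inside `A` and combined by a diagonal
sequence.

A jointly unital family of order zero maps on a finite `G`-set is encoded by positive elements,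
orthogonal within each map and permuted by `G` (`exists_isRokhlinFamily`). Cutting representatives
down by an approximate unit of `D` gives elements of `A` that satisfy finitely many of the relations
up to a small error (`IsRokhlinFamily.exists_approx`). If `y n l t` are such elements for `G ⧸ N n`
and `x n t` is a point of the completion over `t`, then `φ l f` is the class of the sequence `∑ t, f
(x n t) • y n l t` (`exists_equivariantOrderZero_of_approx`). The errors are chosen small against
the order of `G ⧸ N n`, so the relations become exact in `F(D, A)`. The sample points need not be
permuted by `G`, but a continuous `f` is nearly constant on the fibres over `G ⧸ N n` for large `n`,
and this restores equivariance. Complete positivity follows from positivity by approximating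
functions by step functions. -/

/-! ### General facts on C*-algebras -/

section CStarFacts

/-- An injective *-homomorphism of C*-algebras reflects positivity. -/
theorem exists_star_mul_self_of_map {B C : Type*} [NonUnitalCStarAlgebra B]
    [NonUnitalCStarAlgebra C] (f : B →⋆ₙₐ[ℂ] C) (hf : Function.Injective f) {b : B} {w : C}
    (hw : f b = star w * w) : ∃ c : B, b = star c * c := by
  let _ : PartialOrder B := CStarAlgebra.spectralOrder _
  let _ : StarOrderedRing B := CStarAlgebra.spectralOrderedRing _
  let _ : PartialOrder C := CStarAlgebra.spectralOrder _
  let _ : StarOrderedRing C := CStarAlgebra.spectralOrderedRing _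
  have hb : 0 ≤ f b := hw ▸ star_mul_self_nonneg w
  have hsa : IsSelfAdjoint b := by
    apply hf
    rw [map_star]
    exact (IsSelfAdjoint.of_nonneg hb).star_eq
  -- The functional calculus commutes with `f`, so `f` sends the negative part of `b` to that of `f
  -- b`, which vanishes; injectivity then kills the negative part of `b`.
  have h1 : f (b⁻) = (f b)⁻ := by
    rw [CFC.negPart_def, CFC.negPart_def]
    exact NonUnitalStarAlgHomClass.map_cfcₙ (S := ℂ) f _ b (by fun_prop) (by simp)
      (map_continuous f) hsa (hsa.map f)
  rw [CFC.negPart_eq_zero_iff (f b) |>.mpr hb, ← map_zero f] at h1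
  exact CStarAlgebra.nonneg_iff_eq_star_mul_self.mp ((CFC.negPart_eq_zero_iff b).mp (hf h1))

/-- This is the Cauchy–Schwarz inequality in the Hilbert module `ι → B` for the vectors `star (z i)`
and `c i • star (z i)`. It handles complex coefficients, and the bound does not grow with the number
of summands. -/
theorem norm_sum_smul_star_mul_self_le {B ι : Type*} [NonUnitalCStarAlgebra B] [Fintype ι]
    (c : ι → ℂ) (z : ι → B) {r : ℝ} (hr : 0 ≤ r) (hc : ∀ i, ‖c i‖ ≤ r) :
    ‖∑ i, c i • (star (z i) * z i)‖ ≤ r * ‖∑ i, star (z i) * z i‖ := by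
  let _ : PartialOrder B := CStarAlgebra.spectralOrder _
  let _ : StarOrderedRing B := CStarAlgebra.spectralOrderedRing _
  let x : WithCStarModule B (ι → B) := (WithCStarModule.equiv B _).symm fun i => star (z i)
  let y : WithCStarModule B (ι → B) := (WithCStarModule.equiv B _).symm fun i => c i • star (z i)
  set S := ∑ i, star (z i) * z i with hS
  have hxy : inner B x y = ∑ i, c i • (star (z i) * z i) := by
    rw [WithCStarModule.pi_inner]
    simp [x, y, WithCStarModule.inner_def, smul_mul_assoc]
  have hx : ‖x‖ ^ 2 = ‖S‖ := by
    rw [WithCStarModule.pi_norm_sq]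
    simp [x, WithCStarModule.inner_def, hS]
  have hy : ‖y‖ ^ 2 ≤ r ^ 2 * ‖S‖ := by
    rw [WithCStarModule.pi_norm_sq]
    have hsum : ∑ i, inner B (y i) (y i) = ∑ i, (‖c i‖ ^ 2 : ℝ) • (star (z i) * z i) := by
      refine Finset.sum_congr rfl fun i _ => ?_
      simp only [y, WithCStarModule.inner_def, WithCStarModule.equiv_symm_pi_apply, star_smul,
        star_star, smul_mul_assoc, mul_smul_comm, smul_smul]
      rw [← Complex.coe_smul]
      congr 1
      rw [Complex.star_def, Complex.conj_mul']
      push_cast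
      ring
    have hle : ∑ i, (‖c i‖ ^ 2 : ℝ) • (star (z i) * z i) ≤ (r ^ 2 : ℝ) • S := by
      rw [hS, Finset.smul_sum]
      refine Finset.sum_le_sum fun i _ => ?_
      exact smul_le_smul_of_nonneg_right (pow_le_pow_left₀ (norm_nonneg _) (hc i) 2)
        (star_mul_self_nonneg _)
    have hnn : 0 ≤ ∑ i, (‖c i‖ ^ 2 : ℝ) • (star (z i) * z i) :=
      Finset.sum_nonneg fun i _ => smul_nonneg (by positivity) (star_mul_self_nonneg _)
    rw [hsum]
    refine (CStarAlgebra.norm_le_norm_of_nonneg_of_le hnn hle).trans ?_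
    rw [norm_smul, Real.norm_of_nonneg (by positivity)]
  rw [← hxy]
  refine (CStarModule.norm_inner_le (WithCStarModule B (ι → B))).trans ?_
  refine abs_le_of_sq_le_sq' ?_ (by positivity) |>.2
  calc (‖x‖ * ‖y‖) ^ 2 = ‖x‖ ^ 2 * ‖y‖ ^ 2 := by ring
    _ ≤ ‖S‖ * (r ^ 2 * ‖S‖) := by rw [hx]; gcongr
    _ = (r * ‖S‖) ^ 2 := by ring

/-- A closed *-subalgebra contains strict contractions `e` for which `star e * e` is approximately
a unit on a given finite subset. -/
theorem exists_approx_unit_finset {A : Type*} [NonUnitalCStarAlgebra A]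
    (D : NonUnitalStarSubalgebra ℂ A) (hD : IsClosed (D : Set A)) (U : Finset A)
    (hU : ∀ u ∈ U, u ∈ D) {ε : ℝ} (hε : 0 < ε) :
    ∃ e ∈ D, ‖e‖ < 1 ∧ ∀ u ∈ U, ‖star e * e * u - u‖ < ε ∧ ‖u * (star e * e) - u‖ < ε := by
  have : IsClosed (D : Set A) := hD
  let _ : PartialOrder D := CStarAlgebra.spectralOrder _
  let _ : StarOrderedRing D := CStarAlgebra.spectralOrderedRing _
  have hA := CStarAlgebra.increasingApproximateUnit D
  set l := CStarAlgebra.approximateUnit D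
  have h1 : ∀ u ∈ U, ∀ᶠ e : D in l,
      ‖star (e : A) * e * u - u‖ < ε / 2 ∧ ‖u * (star (e : A) * e) - u‖ < ε / 2 := by
    intro u hu
    have hl := hA.tendsto_mul_right ⟨u, hU u hu⟩
    have hr := hA.tendsto_mul_left ⟨u, hU u hu⟩
    filter_upwards [Metric.tendsto_nhds.mp hl (ε / 4) (by positivity),
      Metric.tendsto_nhds.mp hr (ε / 4) (by positivity), hA.eventually_norm,
      hA.eventually_star_eq] with e h2 h3 h4 h5
    have h5' : star (e : A) = e := congrArg Subtype.val h5
    have h4' : ‖(e : A)‖ ≤ 1 := h4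
    rw [dist_eq_norm] at h2 h3
    have h2' : ‖(e : A) * u - u‖ < ε / 4 := h2
    have h3' : ‖u * (e : A) - u‖ < ε / 4 := h3
    rw [h5']
    constructor
    · calc ‖(e : A) * e * u - u‖ = ‖(e : A) * (e * u - u) + (e * u - u)‖ := by
            congr 1; noncomm_ring
        _ ≤ ‖(e : A)‖ * ‖e * u - u‖ + ‖e * u - u‖ :=
            (norm_add_le _ _).trans (by gcongr; exact norm_mul_le _ _)
        _ ≤ 1 * ‖e * u - u‖ + ‖e * u - u‖ := by gcongr
        _ < ε / 2 := by linarith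
    · calc ‖u * ((e : A) * e) - u‖ = ‖(u * e - u) * e + (u * e - u)‖ := by
            congr 1; noncomm_ring
        _ ≤ ‖u * e - u‖ * ‖(e : A)‖ + ‖u * e - u‖ :=
            (norm_add_le _ _).trans (by gcongr; exact norm_mul_le _ _)
        _ ≤ ‖u * e - u‖ * 1 + ‖u * e - u‖ := by gcongr
        _ < ε / 2 := by linarith
  obtain ⟨e, he1, he2⟩ :=
    (((Filter.eventually_all_finset U).mpr h1).and hA.eventually_norm).exists
  have he2' : ‖(e : A)‖ ≤ 1 := he2
  -- Scaling by `r` slightly below 1 makes the norm strictly less than 1, and the slack between `ε /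
  -- 2` and `ε` absorbs the change.
  have hs : ∀ u ∈ U, ∀ᶠ r : ℝ in nhdsWithin 1 (Set.Iio 1),
      ‖r ^ 2 • (star (e : A) * e * u) - u‖ < ε ∧ ‖r ^ 2 • (u * (star (e : A) * e)) - u‖ < ε := by
    intro u hu
    have hc : ∀ w : A, Filter.Tendsto (fun r : ℝ => ‖r ^ 2 • w - u‖) (nhdsWithin 1 (Set.Iio 1))
        (nhds ‖w - u‖) := by
      intro w
      have : Continuous (fun r : ℝ => ‖r ^ 2 • w - u‖) := by fun_prop
      have h := this.tendsto 1
      norm_num at h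
      exact h.mono_left nhdsWithin_le_nhds
    exact ((hc _).eventually (gt_mem_nhds (by linarith [(he1 u hu).1]))).and
      ((hc _).eventually (gt_mem_nhds (by linarith [(he1 u hu).2])))
  have hpos : ∀ᶠ r : ℝ in nhdsWithin 1 (Set.Iio 1), 0 < r :=
    nhdsWithin_le_nhds (lt_mem_nhds one_pos)
  obtain ⟨r, hr1, hr2, hr3⟩ := (((Filter.eventually_all_finset U).mpr hs).and
    (hpos.and (self_mem_nhdsWithin))).exists
  refine ⟨r • (e : A), (r • e).2, ?_, fun u hu => ?_⟩
  · rw [norm_smul, Real.norm_of_nonneg hr2.le]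
    have : r < 1 := hr3
    nlinarith [norm_nonneg (e : A)]
  · have hq : star (r • (e : A)) * (r • (e : A)) = r ^ 2 • (star (e : A) * e) := by
      rw [star_smul, star_trivial, smul_mul_smul_comm, pow_two]
    rw [hq, smul_mul_assoc, mul_smul_comm]
    exact hr1 u hu

end CStarFacts

/-! ### Norms and positivity in `A_∞` and `F(D, A)` -/

section SequenceFacts

variable {A : Type v} [NonUnitalCStarAlgebra A]

theorem BddSeq.sum_apply {ι : Type*} (s : Finset ι) (f : ι → BddSeq A) (k : ℕ) :
    (∑ i ∈ s, f i) k = ∑ i ∈ s, f i k :=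
  map_sum (⟨⟨fun x : BddSeq A => x k, rfl⟩, fun _ _ => rfl⟩ : BddSeq A →+ A) f s

theorem SeqAlg.eventually_norm_lt {x : BddSeq A} {r : ℝ} (h : ‖(c0Ideal A).proj x‖ < r) :
    ∀ᶠ k in Filter.atTop, ‖x k‖ < r := by
  obtain ⟨y, hy, hyr⟩ := (c0Ideal A).exists_norm_lt ((c0Ideal A).proj x) (sub_pos.mpr h)
  have hxy : Filter.Tendsto (fun k => ‖(x - y) k‖) Filter.atTop (nhds 0) := by
    have h0 : Filter.Tendsto (fun k => (x - y) k) Filter.atTop (nhds 0) :=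
      (c0Ideal A).mkₗ_eq_iff.mp (show (c0Ideal A).mkₗ x = (c0Ideal A).mkₗ y from hy.symm)
    simpa using h0.norm
  have hlt : ‖y‖ < r := by linarith
  filter_upwards [hxy.eventually (gt_mem_nhds (sub_pos.mpr hlt))] with k hk
  have h1 : ‖x k‖ ≤ ‖(x - y) k‖ + ‖y k‖ := by
    simpa using norm_add_le ((x - y) k) (y k)
  have h2 : ‖y k‖ ≤ ‖y‖ := lp.norm_apply_le_norm (by simp) y k
  linarith

theorem SeqAlg.proj_eq_zero_iff {x : BddSeq A} :
    (c0Ideal A).proj x = 0 ↔ Filter.Tendsto (fun k => x k) Filter.atTop (nhds 0) := by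
  rw [← map_zero (c0Ideal A).proj, ClosedStarIdeal.proj_eq_iff, sub_zero]
  rfl

/-- The class in `A_∞` of a bounded sequence of positive elements is of the form `star w * w`. -/
theorem SeqAlg.exists_star_mul_self [PartialOrder A] [StarOrderedRing A] (x : BddSeq A)
    (hx : ∀ k, 0 ≤ x k) : ∃ w : SeqAlg A, (c0Ideal A).proj x = star w * w := by
  have h : ∀ k, ∃ w : A, x k = star w * w := fun k =>
    CStarAlgebra.nonneg_iff_eq_star_mul_self.mp (hx k)
  choose w hw using h
  have hb : Memℓp w ∞ := by
    -- Since `‖w k‖ ^ 2 ≤ ‖x‖`, this bound works without a square root.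
    refine memℓp_infty ⟨‖x‖ + 1, ?_⟩
    rintro _ ⟨k, rfl⟩
    have h1 : ‖w k‖ * ‖w k‖ ≤ ‖x‖ := by
      rw [← CStarRing.norm_star_mul_self, ← hw k]
      exact lp.norm_apply_le_norm (by simp) x k
    dsimp only
    nlinarith [norm_nonneg (w k), norm_nonneg x]
  refine ⟨(c0Ideal A).proj ⟨w, hb⟩, ?_⟩
  rw [← map_star, ← map_mul]
  congr 1
  ext k
  exact hw k

variable {D : NonUnitalStarSubalgebra ℂ A}

/-- Changing `x` by an element of the annihilator does not change its product with `w`, so a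
representative of nearly minimal norm may be used. This turns norms in `F(D, A)` into estimates in
`A_∞`. -/
theorem norm_mul_const_le (x : relCommutant D) {w : A} (hw : w ∈ D) :
    ‖(x : SeqAlg A) * SeqAlg.const w‖ ≤ ‖(annIdeal D).proj x‖ * ‖w‖ := by
  refine le_of_forall_pos_le_add fun ε hε => ?_
  obtain ⟨y, hy, hyr⟩ := (annIdeal D).exists_norm_lt ((annIdeal D).proj x)
    (show 0 < ε / (‖w‖ + 1) by positivity)
  have h0 : ((x - y : relCommutant D) : SeqAlg A) * SeqAlg.const w = 0 :=
    ((annIdeal D).mkₗ_eq_iff.mp (show (annIdeal D).mkₗ x = (annIdeal D).mkₗ y from hy.symm) w hw).1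
  have h1 : (x : SeqAlg A) * SeqAlg.const w = (y : SeqAlg A) * SeqAlg.const w := by
    rw [← sub_eq_zero, ← sub_mul]; exact h0
  have h2 : ‖SeqAlg.const w‖ ≤ ‖w‖ := NonUnitalStarAlgHom.norm_apply_le _ _
  rw [h1]
  calc ‖(y : SeqAlg A) * SeqAlg.const w‖ ≤ ‖(y : SeqAlg A)‖ * ‖SeqAlg.const w‖ := norm_mul_le _ _
    _ ≤ (‖(annIdeal D).proj x‖ + ε / (‖w‖ + 1)) * ‖w‖ := by
        gcongr
        exact hyr.le
    _ = ‖(annIdeal D).proj x‖ * ‖w‖ + ε * (‖w‖ / (‖w‖ + 1)) := by ring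
    _ ≤ _ := by
        gcongr
        refine mul_le_of_le_one_right hε.le ?_
        rw [div_le_one (by positivity)]
        linarith

theorem mul_const_eq_zero {x : relCommutant D} (hx : (annIdeal D).proj x = 0) {w : A}
    (hw : w ∈ D) : (x : SeqAlg A) * SeqAlg.const w = 0 := by
  have h := norm_mul_const_le x hw
  rw [hx, norm_zero, zero_mul] at h
  exact norm_le_zero_iff.mp h

/-- One side suffices because `x` commutes with `D`. -/
theorem proj_eq_zero_of_mul_const {x : relCommutant D}
    (hx : ∀ w ∈ D, (x : SeqAlg A) * SeqAlg.const w = 0) : (annIdeal D).proj x = 0 := by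
  rw [← map_zero (annIdeal D).proj, ClosedStarIdeal.proj_eq_iff, sub_zero]
  exact fun w hw => ⟨hx w hw, by rw [← x.2 w hw, hx w hw]⟩

/-- The class in `F(D, A)` of a positive element of `A_∞` that commutes with `D` is positive. -/
theorem proj_nonneg (x : relCommutant D) {w : SeqAlg A} (hw : (x : SeqAlg A) = star w * w) :
    0 ≤ (annIdeal D).proj x := by
  -- The element `w` need not commute with `D`, so its class in `F(D, A)` may not exist; a square
  -- root inside the commutant is needed.
  obtain ⟨c, rfl⟩ := exists_star_mul_self_of_map
    (NonUnitalStarSubalgebraClass.subtype (relCommutant D)) Subtype.val_injective hw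
  rw [map_mul, map_star]
  exact star_mul_self_nonneg _

/-- For separable `D` some element of `A_∞ ∩ D'` acts on `D` as a unit. -/
theorem exists_relCommutant_mul_const_eq (hD : IsClosed (D : Set A))
    (hsep : TopologicalSpace.IsSeparable (D : Set A)) :
    ∃ e : relCommutant D, ∀ w ∈ D, (e : SeqAlg A) * SeqAlg.const w = SeqAlg.const w := by
  classical
  have : TopologicalSpace.SeparableSpace D := hsep.separableSpace
  let s : ℕ → D := TopologicalSpace.denseSeq D
  -- The term with index `n` is a unit up to `1 / (n + 1)` on the first `n + 1` points of a dense
  -- sequence of `D`.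
  have hex : ∀ n : ℕ, ∃ e ∈ D, ‖e‖ < 1 ∧ ∀ u ∈ (Finset.range (n + 1)).image fun i => (s i : A),
      ‖star e * e * u - u‖ < 1 / ((n : ℝ) + 1) ∧ ‖u * (star e * e) - u‖ < 1 / ((n : ℝ) + 1) := by
    intro n
    refine exists_approx_unit_finset D hD _ ?_ (by positivity)
    intro u hu
    obtain ⟨i, _, rfl⟩ := Finset.mem_image.mp hu
    exact (s i).2
  choose e heD he1 he using hex
  have hn : ∀ n, ‖star (e n) * e n‖ ≤ 1 := by
    intro n
    rw [CStarRing.norm_star_mul_self]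
    nlinarith [he1 n, norm_nonneg (e n)]
  let q : BddSeq A := ⟨fun n => star (e n) * e n, memℓp_infty ⟨1, by rintro _ ⟨n, rfl⟩; exact hn n⟩⟩
  have hq : ∀ n, q n = star (e n) * e n := fun n => rfl
  have hlim : Filter.Tendsto (fun n : ℕ => 1 / ((n : ℝ) + 1)) Filter.atTop (nhds 0) :=
    tendsto_one_div_add_atTop_nhds_zero_nat
  have hmem : ∀ i n, i ≤ n → (s i : A) ∈ (Finset.range (n + 1)).image fun i => (s i : A) :=
    fun i n hin => Finset.mem_image_of_mem _ (Finset.mem_range.mpr (by omega))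
  have hL : ∀ w : D, (c0Ideal A).proj q * SeqAlg.const (w : A) = SeqAlg.const (w : A) := by
    intro w
    refine (TopologicalSpace.denseRange_denseSeq D).induction_on w
      (isClosed_eq (by fun_prop) (by fun_prop)) ?_
    intro i
    rw [← sub_eq_zero]
    refine (SeqAlg.proj_eq_zero_iff (x := q * constSeq (s i : A) - constSeq (s i : A))).mpr ?_
    refine squeeze_zero_norm' ?_ hlim
    filter_upwards [Filter.eventually_ge_atTop i] with n hn
    exact (he n _ (hmem i n hn)).1.le
  -- Both one-sided identities are needed to place the class of `q` in the commutant of `D`.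
  have hR : ∀ w : D, SeqAlg.const (w : A) * (c0Ideal A).proj q = SeqAlg.const (w : A) := by
    intro w
    refine (TopologicalSpace.denseRange_denseSeq D).induction_on w
      (isClosed_eq (by fun_prop) (by fun_prop)) ?_
    intro i
    rw [← sub_eq_zero]
    refine (SeqAlg.proj_eq_zero_iff (x := constSeq (s i : A) * q - constSeq (s i : A))).mpr ?_
    refine squeeze_zero_norm' ?_ hlim
    filter_upwards [Filter.eventually_ge_atTop i] with n hn
    exact (he n _ (hmem i n hn)).2.le
  exact ⟨⟨(c0Ideal A).proj q, fun w hw => by rw [hL ⟨w, hw⟩, hR ⟨w, hw⟩]⟩,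
    fun w hw => hL ⟨w, hw⟩⟩

/-- A representative of the unit of `F(D, A)` acts on `D` as a unit. -/
theorem mul_const_eq_of_isUnitOf (hD : IsClosed (D : Set A))
    (hsep : TopologicalSpace.IsSeparable (D : Set A)) {x : relCommutant D}
    (hx : IsUnitOf ((annIdeal D).proj x)) {w : A} (hw : w ∈ D) :
    (x : SeqAlg A) * SeqAlg.const w = SeqAlg.const w := by
  obtain ⟨e, he⟩ := exists_relCommutant_mul_const_eq hD hsep
  -- The unit property is applied to the class of `e`; since `e` fixes `w`, multiplying by `w`
  -- leaves `x w - w`.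
  have h0 : (annIdeal D).proj (x * e - e) = 0 := by
    rw [map_sub, map_mul, (hx _).1, sub_self]
  have h1 := mul_const_eq_zero h0 hw
  change ((x : SeqAlg A) * e - e) * SeqAlg.const w = 0 at h1
  rwa [sub_mul, mul_assoc, he w hw, sub_eq_zero] at h1

theorem isUnitOf_of_mul_const_eq {x : relCommutant D}
    (hx : ∀ w ∈ D, (x : SeqAlg A) * SeqAlg.const w = SeqAlg.const w) :
    IsUnitOf ((annIdeal D).proj x) := by
  intro b
  obtain ⟨y, rfl⟩ := (annIdeal D).proj_surjective b
  constructor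
  · rw [← map_mul, ← sub_eq_zero, ← map_sub]
    refine proj_eq_zero_of_mul_const fun w hw => ?_
    change ((x : SeqAlg A) * y - y) * SeqAlg.const w = 0
    rw [sub_mul, mul_assoc, y.2 w hw, ← mul_assoc, hx w hw, sub_self]
  · rw [← map_mul, ← sub_eq_zero, ← map_sub]
    refine proj_eq_zero_of_mul_const fun w hw => ?_
    change ((y : SeqAlg A) * x - y) * SeqAlg.const w = 0
    rw [sub_mul, mul_assoc, hx w hw, sub_self]

end SequenceFacts

/-! ### Rokhlin families and their approximate lifts -/

section Lifts

variable {G : Type u} [Group G] {A : Type v} [NonUnitalCStarAlgebra A] {α : G →* (A ≃⋆ₐ[ℂ] A)}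
  {D : NonUnitalStarSubalgebra ℂ A}

/-- The values on minimal projections of a family, indexed by `L`, of equivariant c.c.p. order zero
maps `C(Q) → F(D, A)` that are jointly unital, for a finite `G`-set `Q`. -/
structure IsRokhlinFamily {L Q : Type*} [Fintype L] [Fintype Q] [MulAction G Q]
    (hD : IsInvariantSub α D) (b : L → Q → CentralSeqAlg D) : Prop where
  nonneg : ∀ l t, 0 ≤ b l t
  mul_eq_zero : ∀ l s t, s ≠ t → b l s * b l t = 0
  norm_sum_le : ∀ l, ‖∑ t, b l t‖ ≤ 1
  equivariant : ∀ l g t, centralAction hD g (b l t) = b l (g • t)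
  isUnitOf : IsUnitOf (∑ l, ∑ t, b l t)

/-- Elements of `A` that satisfy the relations of a Rokhlin family up to `ε` on `U ⊆ D`, for the
group elements in `K`. -/
structure IsApproxRokhlinFamily {L Q : Type*} [Fintype L] [Fintype Q] [MulAction G Q]
    (α : G →* (A ≃⋆ₐ[ℂ] A)) (U : Finset A) (K : Finset G) (ε : ℝ) (y : L → Q → A) : Prop where
  exists_eq : ∀ l t, ∃ z, y l t = star z * z
  norm_sum_le : ∀ l, ‖∑ t, y l t‖ ≤ 1
  comm : ∀ l t, ∀ u ∈ U, ‖y l t * u - u * y l t‖ ≤ ε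
  mul : ∀ l s t, s ≠ t → ∀ u ∈ U, ‖y l s * y l t * u‖ ≤ ε
  equivariant : ∀ l t, ∀ g ∈ K, ∀ u ∈ U, ‖(α g (y l t) - y l (g • t)) * u‖ ≤ ε
  unit : ∀ u ∈ U, ‖(∑ l, ∑ t, y l t) * u - u‖ ≤ ε

theorem IsRokhlinFamily.norm_le {L Q : Type*} [Fintype L] [Fintype Q] [MulAction G Q]
    {hD : IsInvariantSub α D} {b : L → Q → CentralSeqAlg D} (hb : IsRokhlinFamily hD b)
    (l : L) (t : Q) : ‖b l t‖ ≤ 1 :=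
  (CStarAlgebra.norm_le_norm_of_nonneg_of_le (hb.nonneg l t)
    (Finset.single_le_sum (f := b l) (fun s _ => hb.nonneg l s) (Finset.mem_univ t))).trans
    (hb.norm_sum_le l)

/-- The relations hold only modulo the annihilator of `D`. Multiplying representatives by an element
of `D` that is nearly a unit on `U` turns them into estimates in `A_∞`, hence in almost all
coordinates. There are finitely many estimates, so a single coordinate satisfies them all. -/
theorem IsRokhlinFamily.exists_approx {L Q : Type*} [Fintype L] [Fintype Q] [MulAction G Q]
    {hD : IsInvariantSub α D} {b : L → Q → CentralSeqAlg D} (hb : IsRokhlinFamily hD b)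
    (hDc : IsClosed (D : Set A)) (hsep : TopologicalSpace.IsSeparable (D : Set A))
    (U : Finset A) (hU : ∀ u ∈ U, u ∈ D) (K : Finset G) {ε : ℝ} (hε : 0 < ε) :
    ∃ y : L → Q → A, IsApproxRokhlinFamily α U K ε y := by
  classical
  have hc : ∀ l t, ∃ c : relCommutant D, b l t = (annIdeal D).proj (star c * c) := by
    intro l t
    obtain ⟨z, hz⟩ := CStarAlgebra.nonneg_iff_eq_star_mul_self.mp (hb.nonneg l t)
    obtain ⟨c, rfl⟩ := (annIdeal D).proj_surjective z
    exact ⟨c, by rw [hz, map_mul, map_star]⟩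
  choose c hc using hc
  have hx : ∀ l t, ∃ x : BddSeq A, (c0Ideal A).proj x = c l t :=
    fun l t => (c0Ideal A).proj_surjective _
  choose x hx using hx
  -- Including the translates of `U` by inverses of elements of `K` makes `α g (star e * e)` act
  -- nearly as a unit on `U` as well.
  obtain ⟨e, heD, he1, he⟩ := exists_approx_unit_finset D hDc
    (U ∪ (K ×ˢ U).image fun p => α p.1⁻¹ p.2) (by
      intro u hu
      rcases Finset.mem_union.mp hu with hu | hu
      · exact hU u hu
      · obtain ⟨p, hp, rfl⟩ := Finset.mem_image.mp hu
        exact hD _ _ (hU _ (Finset.mem_product.mp hp).2)) (half_pos hε)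
  set q : A := star e * e with hq
  have hqD : q ∈ D := mul_mem (star_mem heD) heD
  have hq1 : ‖q‖ < 1 := by
    rw [hq, CStarRing.norm_star_mul_self]
    nlinarith [norm_nonneg e]
  have heU : ∀ u ∈ U, ‖q * u - u‖ < ε / 2 ∧ ‖u * q - u‖ < ε / 2 :=
    fun u hu => he u (Finset.mem_union_left _ hu)
  set p : L → Q → relCommutant D := fun l t => star (c l t) * c l t with hp
  have hpb : ∀ l t, (annIdeal D).proj (p l t) = b l t := fun l t => (hc l t).symm
  -- In this form every coordinate is exactly of the form `star z * z`; as `p l t` commutes with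
  -- `D`, the class is still `p l t` times `q`.
  obtain ⟨Y, hYdef⟩ : ∃ Y : L → Q → BddSeq A, ∀ l t, Y l t =
      star (x l t * constSeq e) * (x l t * constSeq e) := ⟨_, fun _ _ => rfl⟩
  have hY : ∀ l t, (c0Ideal A).proj (Y l t) = (p l t : SeqAlg A) * SeqAlg.const q := by
    intro l t
    have h1 : (c0Ideal A).proj (Y l t)
        = star (SeqAlg.const e) * (p l t : SeqAlg A) * SeqAlg.const e := by
      have h2 : (c0Ideal A).proj (x l t * constSeq e) = (c l t : SeqAlg A) * SeqAlg.const e := by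
        rw [map_mul, hx]; rfl
      rw [hYdef, map_mul, map_star, h2, star_mul]
      change star (SeqAlg.const e) * star (c l t : SeqAlg A) * ((c l t : SeqAlg A) * SeqAlg.const e)
        = star (SeqAlg.const e) * (star (c l t : SeqAlg A) * (c l t : SeqAlg A)) * SeqAlg.const e
      simp only [mul_assoc]
    rw [h1, ← map_star, ← (p l t).2 _ (star_mem heD), mul_assoc, ← map_mul]
  clear_value q
  have hproj : ∀ u, (c0Ideal A).proj (constSeq u) = SeqAlg.const u := fun u => rfl
  -- Only strict bounds in `A_∞` pass to coordinates, which is why `‖q‖ < 1` was arranged.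
  have hone : ∀ l, ∀ᶠ k in Filter.atTop, ‖(∑ t, Y l t) k‖ < 1 := by
    intro l
    apply SeqAlg.eventually_norm_lt
    have h1 : (c0Ideal A).proj (∑ t, Y l t)
        = ((∑ t, p l t : relCommutant D) : SeqAlg A) * SeqAlg.const q := by
      rw [map_sum, AddSubmonoidClass.coe_finsetSum, Finset.sum_mul]
      exact Finset.sum_congr rfl fun t _ => hY l t
    rw [h1]
    refine (norm_mul_const_le _ hqD).trans_lt ?_
    rw [map_sum]
    simp only [hpb]
    calc ‖∑ t, b l t‖ * ‖q‖ ≤ 1 * ‖q‖ := by gcongr; exact hb.norm_sum_le l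
      _ < 1 := by linarith
  have hcomm : ∀ l t, ∀ u ∈ U, ∀ᶠ k in Filter.atTop,
      ‖(Y l t * constSeq u - constSeq u * Y l t) k‖ < ε := by
    intro l t u hu
    apply SeqAlg.eventually_norm_lt
    have h1 : (c0Ideal A).proj (Y l t * constSeq u - constSeq u * Y l t)
        = (p l t : SeqAlg A) * SeqAlg.const (q * u - u * q) := by
      rw [map_sub, map_mul, map_mul, hY, hproj, ← mul_assoc, ← (p l t).2 u (hU u hu)]
      simp only [mul_assoc, map_sub, map_mul, mul_sub]
    rw [h1]
    refine (norm_mul_const_le _ (sub_mem (mul_mem hqD (hU u hu)) (mul_mem (hU u hu) hqD))).trans_lt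
      ?_
    rw [hpb]
    have h2 : ‖q * u - u * q‖ ≤ ‖q * u - u‖ + ‖u * q - u‖ := by
      simpa using norm_sub_le (q * u - u) (u * q - u)
    calc ‖b l t‖ * ‖q * u - u * q‖ ≤ 1 * ‖q * u - u * q‖ := by gcongr; exact hb.norm_le l t
      _ < ε := by linarith [heU u hu]
  have hmul : ∀ l s t, s ≠ t → ∀ u ∈ U, ∀ᶠ k in Filter.atTop,
      ‖(Y l s * Y l t * constSeq u) k‖ < ε := by
    intro l s t hst u hu
    apply SeqAlg.eventually_norm_lt
    have h1 : (c0Ideal A).proj (Y l s * Y l t * constSeq u)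
        = ((p l s * p l t : relCommutant D) : SeqAlg A) * SeqAlg.const (q * (q * u)) := by
      rw [map_mul, map_mul, hY, hY, hproj]
      change _ = (p l s : SeqAlg A) * (p l t : SeqAlg A) * _
      rw [mul_assoc (p l s : SeqAlg A), ← mul_assoc (SeqAlg.const q), ← (p l t).2 q hqD]
      simp only [mul_assoc, map_mul]
    rw [h1, mul_const_eq_zero _ (mul_mem hqD (mul_mem hqD (hU u hu))), norm_zero]
    · exact hε
    · rw [map_mul, hpb, hpb, hb.mul_eq_zero l s t hst]
  have hequi : ∀ l t, ∀ g ∈ K, ∀ u ∈ U, ∀ᶠ k in Filter.atTop,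
      ‖((BddSeq.map (α g : A →⋆ₙₐ[ℂ] A) (Y l t) - Y l (g • t)) * constSeq u) k‖ < ε := by
    intro l t g hg u hu
    apply SeqAlg.eventually_norm_lt
    -- Both `p'` and `p l (g • t)` represent `b l (g • t)`, so they agree after multiplication by
    -- `D`; the only error left comes from `α g q` differing from `q`.
    set p' : relCommutant D := commutantAction hD g (p l t) with hp'
    have hp'b : (annIdeal D).proj p' = b l (g • t) := by
      rw [← hb.equivariant, ← hpb]; rfl
    have h1 : (c0Ideal A).proj ((BddSeq.map (α g : A →⋆ₙₐ[ℂ] A) (Y l t) - Y l (g • t)) * constSeq u)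
        = (p' : SeqAlg A) * SeqAlg.const (α g q * u - q * u) := by
      have h2 : (c0Ideal A).proj (BddSeq.map (α g : A →⋆ₙₐ[ℂ] A) (Y l t))
          = (p' : SeqAlg A) * SeqAlg.const (α g q) := by
        change seqAction α g ((c0Ideal A).proj (Y l t)) = _
        rw [hY, map_mul, seqAction_const]
        rfl
      have h3 : (p' : SeqAlg A) * SeqAlg.const (q * u)
          = (p l (g • t) : SeqAlg A) * SeqAlg.const (q * u) := by
        rw [← sub_eq_zero, ← sub_mul]
        refine mul_const_eq_zero (x := p' - p l (g • t)) ?_ (mul_mem hqD (hU u hu))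
        rw [map_sub, hp'b, hpb, sub_self]
      rw [map_mul, map_sub, h2, hY, hproj, map_sub, mul_sub, h3, sub_mul, mul_assoc, mul_assoc,
        ← map_mul, ← map_mul]
    rw [h1]
    have huD := hU u hu
    refine (norm_mul_const_le _ (sub_mem (mul_mem (hD g q hqD) huD) (mul_mem hqD huD))).trans_lt ?_
    rw [hp'b]
    have hinv : α g (α g⁻¹ u) = u := by
      rw [← StarAlgEquiv.mul_apply, ← map_mul, mul_inv_cancel, map_one, StarAlgEquiv.one_apply]
    have h4 : ‖α g q * u - u‖ < ε / 2 := by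
      have h5 := (he (α g⁻¹ u) (Finset.mem_union_right _ (Finset.mem_image.mpr
        ⟨(g, u), Finset.mem_product.mpr ⟨hg, hu⟩, rfl⟩))).1
      have h6 : α g q * u - u = (α g : A →⋆ₙₐ[ℂ] A) (q * α g⁻¹ u - α g⁻¹ u) := by
        change _ = α g (q * α g⁻¹ u - α g⁻¹ u)
        rw [map_sub, map_mul, hinv]
      rw [h6]
      exact (NonUnitalStarAlgHom.norm_apply_le _ _).trans_lt h5
    have h7 : ‖α g q * u - q * u‖ ≤ ‖α g q * u - u‖ + ‖q * u - u‖ := by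
      simpa using norm_sub_le (α g q * u - u) (q * u - u)
    calc ‖b l (g • t)‖ * ‖α g q * u - q * u‖ ≤ 1 * ‖α g q * u - q * u‖ := by
          gcongr; exact hb.norm_le l _
      _ < ε := by linarith [heU u hu]
  have hunit : ∀ u ∈ U, ∀ᶠ k in Filter.atTop,
      ‖((∑ l, ∑ t, Y l t) * constSeq u - constSeq u) k‖ < ε := by
    intro u hu
    apply SeqAlg.eventually_norm_lt
    have h1 : (c0Ideal A).proj ((∑ l, ∑ t, Y l t) * constSeq u - constSeq u)
        = SeqAlg.const (q * u - u) := by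
      have h2 : (c0Ideal A).proj (∑ l, ∑ t, Y l t)
          = ((∑ l, ∑ t, p l t : relCommutant D) : SeqAlg A) * SeqAlg.const q := by
        simp only [map_sum, AddSubmonoidClass.coe_finsetSum, Finset.sum_mul, hY]
      have h3 : IsUnitOf ((annIdeal D).proj (∑ l, ∑ t, p l t)) := by
        simp only [map_sum, hpb]
        exact hb.isUnitOf
      rw [map_sub, map_mul, h2, hproj, mul_assoc, ← map_mul,
        mul_const_eq_of_isUnitOf hDc hsep h3 (mul_mem hqD (hU u hu)), map_sub]
    rw [h1]
    refine (NonUnitalStarAlgHom.norm_apply_le _ _).trans_lt ?_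
    linarith [heU u hu]
  have hall : ∀ᶠ k in Filter.atTop, (∀ l, ‖(∑ t, Y l t) k‖ < 1) ∧
      (∀ l t, ∀ u ∈ U, ‖(Y l t * constSeq u - constSeq u * Y l t) k‖ < ε) ∧
      (∀ l s t, s ≠ t → ∀ u ∈ U, ‖(Y l s * Y l t * constSeq u) k‖ < ε) ∧
      (∀ l t, ∀ g ∈ K, ∀ u ∈ U,
        ‖((BddSeq.map (α g : A →⋆ₙₐ[ℂ] A) (Y l t) - Y l (g • t)) * constSeq u) k‖ < ε) ∧
      (∀ u ∈ U, ‖((∑ l, ∑ t, Y l t) * constSeq u - constSeq u) k‖ < ε) := by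
    simp only [Filter.eventually_and, Filter.eventually_all, Filter.eventually_all_finset]
    exact ⟨hone, hcomm, hmul, hequi, hunit⟩
  obtain ⟨k, hk1, hk2, hk3, hk4, hk5⟩ := hall.exists
  have hsum : ∀ l, (∑ t, Y l t) k = ∑ t, Y l t k := fun l =>
    BddSeq.sum_apply _ _ _
  have hsum' : (∑ l, ∑ t, Y l t) k = ∑ l, ∑ t, Y l t k := by simp only [BddSeq.sum_apply]
  refine ⟨fun l t => Y l t k, ⟨fun l t => ⟨x l t k * e, by rw [hYdef]; rfl⟩, fun l => ?_,
    fun l t u hu => (hk2 l t u hu).le, fun l s t hst u hu => (hk3 l s t hst u hu).le,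
    fun l t g hg u hu => (hk4 l t g hg u hu).le, fun u hu => ?_⟩⟩
  · rw [← hsum]; exact (hk1 l).le
  · have := (hk5 u hu).le
    rw [← hsum']
    exact this

end Lifts

/-! ### Positive maps on functions on a profinite space -/

section Profinite

variable {X : Type*} [TopologicalSpace X] {Q : ℕ → Type*}

/-- A sequence of finer and finer finite clopen partitions of `X` that separates points; the parts
of the `n`th partition are the fibres of the surjective map `π n`. -/
structure IsProfinitePartition (π : ∀ n, X → Q n) : Prop where
  isLocallyConstant : ∀ n, IsLocallyConstant (π n)
  surjective : ∀ n, Function.Surjective (π n)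
  mono : ∀ n x y, π (n + 1) x = π (n + 1) y → π n x = π n y
  separates : ∀ x y, (∀ n, π n x = π n y) → x = y

variable {π : ∀ n, X → Q n}

theorem IsProfinitePartition.eq_of_le (hπ : IsProfinitePartition π) {m n : ℕ} (h : m ≤ n)
    {x y : X} (hxy : π n x = π n y) : π m x = π m y := by
  induction n, h using Nat.le_induction with
  | base => exact hxy
  | succ n _ ih => exact ih (hπ.mono n x y hxy)

/-- By compactness: the closed set of pairs on which `f` differs by at least `ε` is covered by the
increasing open sets of pairs separated by `π n`, so one of these contains it. -/
theorem IsProfinitePartition.eventually_norm_sub_lt [CompactSpace X] (hπ : IsProfinitePartition π)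
    (f : C(X, ℂ)) {ε : ℝ} (hε : 0 < ε) :
    ∀ᶠ n in Filter.atTop, ∀ x y, π n x = π n y → ‖f x - f y‖ < ε := by
  have hK : IsCompact {p : X × X | ε ≤ ‖f p.1 - f p.2‖} :=
    (isClosed_le (by fun_prop) (by fun_prop)).isCompact
  have hV : ∀ n, IsOpen {p : X × X | π n p.1 ≠ π n p.2} := by
    intro n
    have h1 : IsLocallyConstant fun p : X × X => (π n p.1, π n p.2) :=
      ((hπ.isLocallyConstant n).comp_continuous continuous_fst).prodMk
        ((hπ.isLocallyConstant n).comp_continuous continuous_snd)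
    exact h1 {q | q.1 ≠ q.2}
  obtain ⟨N, hN⟩ := hK.elim_directed_cover _ hV (by
      intro p hp
      by_contra hcon
      simp only [Set.mem_iUnion, Set.mem_ofPred_eq, not_exists, not_not] at hcon
      have hp' : ε ≤ ‖f p.1 - f p.2‖ := hp
      rw [hπ.separates _ _ hcon, sub_self, norm_zero] at hp'
      linarith) (by
      refine (monotone_nat_of_le_succ fun n p hp => ?_).directed_le
      exact fun h => hp (hπ.mono n _ _ h))
  filter_upwards [Filter.eventually_ge_atTop N] with n hn x y hxy
  by_contra hcon
  exact hN (show (x, y) ∈ _ from not_lt.mp hcon) (hπ.eq_of_le hn hxy)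

/-- The indicator function of a part. -/
noncomputable def IsProfinitePartition.indicator (hπ : IsProfinitePartition π) (n : ℕ) (t : Q n) :
    C(X, ℂ) :=
  open Classical in
  ⟨fun x => if π n x = t then 1 else 0,
    ((hπ.isLocallyConstant n).comp fun s => if s = t then (1 : ℂ) else 0).continuous⟩

theorem IsProfinitePartition.tendsto_approx [CompactSpace X] [∀ n, Fintype (Q n)]
    (hπ : IsProfinitePartition π) {x : ∀ n, Q n → X} (hx : ∀ n t, π n (x n t) = t) (f : C(X, ℂ)) :
    Filter.Tendsto (fun n => ∑ t, f (x n t) • hπ.indicator n t) Filter.atTop (nhds f) := by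
  classical
  rw [Metric.tendsto_nhds]
  intro ε hε
  filter_upwards [hπ.eventually_norm_sub_lt f hε] with n hn
  rw [ContinuousMap.dist_lt_iff hε]
  intro a
  have h1 : (∑ t, f (x n t) • hπ.indicator n t) a = f (x n (π n a)) := by
    rw [ContinuousMap.sum_apply, Finset.sum_eq_single (π n a)]
    · simp [IsProfinitePartition.indicator]
    · intro t _ ht
      simp [IsProfinitePartition.indicator, ht.symm]
    · simp
  rw [h1, dist_eq_norm]
  exact hn _ _ (hx n _)

theorem exists_eq_star_mul_self_of_nonneg {B : Type*} [NonUnitalCStarAlgebra B]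
    [PartialOrder B] [StarOrderedRing B] {b : B} (hb : 0 ≤ b) : ∃ c : B, b = star c * c :=
  CStarAlgebra.nonneg_iff_eq_star_mul_self.mp hb

theorem CStarMatrix.exists_apply_eq_sum_of_nonneg {B : Type*} [NonUnitalCStarAlgebra B]
    [PartialOrder B] [StarOrderedRing B] {k : ℕ} {M : CStarMatrix (Fin k) (Fin k) B}
    (hM : 0 ≤ M) : ∃ N : Fin k → Fin k → B, ∀ i j, M i j = ∑ r, star (N r i) * N r j := by
  obtain ⟨N, rfl⟩ := exists_eq_star_mul_self_of_nonneg hM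
  exact ⟨N, fun i j => by rw [CStarMatrix.mul_apply]; rfl⟩

/-- A positive contraction on `C(X)` is completely positive. -/
theorem IsProfinitePartition.map_cstarMatrix_nonneg [CompactSpace X] [∀ n, Finite (Q n)]
    (hπ : IsProfinitePartition π) {B : Type*} [NonUnitalCStarAlgebra B] [PartialOrder B]
    [StarOrderedRing B] (φ : C(X, ℂ) →ₗ[ℂ] B) (hφ : ∀ f, 0 ≤ f → 0 ≤ φ f)
    (hc : ∀ f, ‖φ f‖ ≤ ‖f‖) (k : ℕ) (M : CStarMatrix (Fin k) (Fin k) C(X, ℂ)) (hM : 0 ≤ M) :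
    0 ≤ M.map φ := by
  classical
  have := fun n => Fintype.ofFinite (Q n)
  have hcont : Continuous φ := AddMonoidHomClass.continuous_of_bound φ 1 (by simpa using hc)
  choose x hx using hπ.surjective
  obtain ⟨N, hN⟩ := CStarMatrix.exists_apply_eq_sum_of_nonneg hM
  have hz : ∀ n t, ∃ z : B, φ (hπ.indicator n t) = star z * z := by
    intro n t
    refine CStarAlgebra.nonneg_iff_eq_star_mul_self.mp (hφ _ ?_)
    intro a
    change (0 : ℂ) ≤ if π n a = t then 1 else 0
    split_ifs <;> simp
  choose z hz using hz
  -- If `M` is written as `star N * N`, its value at `x n t` is a positive scalar matrix, and its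
  -- product with the positive element `φ (indicator)` is `star W * W`. Summing over `t` gives `φ`
  -- of a step approximation of `M`.
  let W : ∀ n, Q n → CStarMatrix (Fin k) (Fin k) B := fun n t =>
    CStarMatrix.ofMatrix fun r j => N r j (x n t) • z n t
  have hlim : Filter.Tendsto (fun n => ∑ t, star (W n t) * W n t) Filter.atTop
      (nhds (M.map φ)) := by
    refine tendsto_pi_nhds.mpr fun i => tendsto_pi_nhds.mpr fun j => ?_
    have h1 := (hcont.tendsto _).comp (hπ.tendsto_approx hx (M i j))
    refine h1.congr fun n => ?_
    have h2 : (∑ t, star (W n t) * W n t) i j = ∑ t, (star (W n t) * W n t) i j :=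
      map_sum (⟨⟨fun V : CStarMatrix (Fin k) (Fin k) B => V i j, rfl⟩, fun _ _ => rfl⟩ :
        CStarMatrix (Fin k) (Fin k) B →+ B) _ _
    rw [h2, Function.comp_apply, map_sum]
    refine Finset.sum_congr rfl fun t _ => ?_
    rw [map_smul, hz, CStarMatrix.mul_apply, hN, ContinuousMap.sum_apply, Finset.sum_smul]
    refine Finset.sum_congr rfl fun r _ => ?_
    change (star (N r i (x n t)) * N r j (x n t)) • (star (z n t) * z n t)
      = star (N r i (x n t) • z n t) * (N r j (x n t) • z n t)
    rw [star_smul, smul_mul_smul_comm]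
  refine ge_of_tendsto hlim (Filter.Eventually.of_forall fun n => ?_)
  exact Finset.sum_nonneg fun t _ => star_mul_self_nonneg _

end Profinite

/-! ### Equivariant order zero maps from approximate Rokhlin families -/

section Limit

variable {A : Type v} [NonUnitalCStarAlgebra A] {X : Type*} [TopologicalSpace X] [CompactSpace X]
  {Q : ℕ → Type*} [∀ n, Fintype (Q n)]

theorem norm_sum_sample_le {ι : Type*} [Fintype ι] (x : ι → X) {z : ι → A}
    (hz : ‖∑ t, star (z t) * z t‖ ≤ 1) (f : C(X, ℂ)) :
    ‖∑ t, f (x t) • (star (z t) * z t)‖ ≤ ‖f‖ :=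
  (norm_sum_smul_star_mul_self_le (fun t => f (x t)) z (norm_nonneg f)
    fun t => f.norm_coe_le_norm (x t)).trans (mul_le_of_le_one_right (norm_nonneg f) hz)

/-- The map that sends `f` to the sequence of the sums `∑ t, f (x n t) • (star (z n t) * z n t)`. -/
noncomputable def sampleSeq (x : ∀ n, Q n → X) (z : ∀ n, Q n → A)
    (hz : ∀ n, ‖∑ t, star (z n t) * z n t‖ ≤ 1) :
    C(X, ℂ) →ₗ[ℂ] BddSeq A where
  toFun f := ⟨fun n => ∑ t, f (x n t) • (star (z n t) * z n t), memℓp_infty ⟨‖f‖, by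
    rintro _ ⟨n, rfl⟩
    exact norm_sum_sample_le (x n) (hz n) f⟩⟩
  map_add' f g := by
    ext n
    change ∑ t, (f (x n t) + g (x n t)) • (star (z n t) * z n t) =
      ∑ t, f (x n t) • (star (z n t) * z n t) + ∑ t, g (x n t) • (star (z n t) * z n t)
    rw [← Finset.sum_add_distrib]
    exact Finset.sum_congr rfl fun t _ => add_smul _ _ _
  map_smul' c f := by
    ext n
    change ∑ t, (c * f (x n t)) • (star (z n t) * z n t) =
      c • ∑ t, f (x n t) • (star (z n t) * z n t)
    rw [Finset.smul_sum]
    exact Finset.sum_congr rfl fun t _ => mul_smul _ _ _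

section SampleSeq

variable (x : ∀ n, Q n → X) (z : ∀ n, Q n → A) (hz : ∀ n, ‖∑ t, star (z n t) * z n t‖ ≤ 1)

theorem sampleSeq_apply (f : C(X, ℂ)) (n : ℕ) :
    sampleSeq x z hz f n = ∑ t, f (x n t) • (star (z n t) * z n t) := rfl

theorem norm_sampleSeq_le (f : C(X, ℂ)) : ‖sampleSeq x z hz f‖ ≤ ‖f‖ :=
  lp.norm_le_of_forall_le (norm_nonneg f) fun n => norm_sum_sample_le (x n) (hz n) f

theorem sampleSeq_star (f : C(X, ℂ)) : sampleSeq x z hz (star f) = star (sampleSeq x z hz f) := by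
  ext n
  change ∑ t, star (f (x n t)) • (star (z n t) * z n t) =
    star (∑ t, f (x n t) • (star (z n t) * z n t))
  rw [star_sum]
  refine Finset.sum_congr rfl fun t _ => ?_
  rw [star_smul, star_mul, star_star]

theorem exists_proj_sampleSeq_eq {f : C(X, ℂ)} (hf : 0 ≤ f) :
    ∃ w : SeqAlg A, (c0Ideal A).proj (sampleSeq x z hz f) = star w * w := by
  let _ : PartialOrder A := CStarAlgebra.spectralOrder _
  let _ : StarOrderedRing A := CStarAlgebra.spectralOrderedRing _
  refine SeqAlg.exists_star_mul_self _ fun n => ?_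
  rw [sampleSeq_apply]
  refine Finset.sum_nonneg fun t _ => ?_
  have h1 : (0 : ℂ) ≤ f (x n t) := hf (x n t)
  have h2 : f (x n t) = ((f (x n t)).re : ℂ) :=
    Complex.ext rfl (by simpa using (Complex.nonneg_iff.mp h1).2.symm)
  rw [h2, Complex.coe_smul]
  exact smul_nonneg (Complex.nonneg_iff.mp h1).1 (star_mul_self_nonneg _)

/-- The errors are added term by term; the resulting cardinality factor must be beaten by the choice
of `ε`. -/
theorem norm_sampleSeq_commutator_le (f : C(X, ℂ)) (n : ℕ) (u : A) {ε : ℝ}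
    (h : ∀ t, ‖star (z n t) * z n t * u - u * (star (z n t) * z n t)‖ ≤ ε) :
    ‖sampleSeq x z hz f n * u - u * sampleSeq x z hz f n‖ ≤ Fintype.card (Q n) * (‖f‖ * ε) := by
  rw [sampleSeq_apply, Finset.sum_mul, Finset.mul_sum, ← Finset.sum_sub_distrib]
  refine (norm_sum_le_of_le _ (n := fun _ => ‖f‖ * ε) fun t _ => ?_).trans (by simp)
  rw [smul_mul_assoc, mul_smul_comm, ← smul_sub, norm_smul]
  gcongr
  · exact f.norm_coe_le_norm _
  · exact h t

/-- The diagonal terms vanish exactly, since `f₁ * f₂` is zero at each sample point; the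
off-diagonal ones are small by approximate orthogonality. -/
theorem norm_sampleSeq_mul_le (f₁ f₂ : C(X, ℂ)) (hf : f₁ * f₂ = 0) (n : ℕ) (u : A) {ε : ℝ}
    (hε : 0 ≤ ε) (h : ∀ s t, s ≠ t →
      ‖star (z n s) * z n s * (star (z n t) * z n t) * u‖ ≤ ε) :
    ‖sampleSeq x z hz f₁ n * sampleSeq x z hz f₂ n * u‖ ≤
      Fintype.card (Q n) * (Fintype.card (Q n) * (‖f₁‖ * ‖f₂‖ * ε)) := by
  rw [sampleSeq_apply, sampleSeq_apply, Finset.sum_mul_sum, Finset.sum_mul]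
  refine (norm_sum_le_of_le _ (n := fun _ => Fintype.card (Q n) * (‖f₁‖ * ‖f₂‖ * ε))
    fun s _ => ?_).trans (by simp)
  rw [Finset.sum_mul]
  refine (norm_sum_le_of_le _ (n := fun _ => ‖f₁‖ * ‖f₂‖ * ε) fun t _ => ?_).trans (by simp)
  rw [smul_mul_smul_comm, smul_mul_assoc, norm_smul]
  by_cases hst : s = t
  · subst hst
    have h0 : f₁ (x n s) * f₂ (x n s) = 0 := DFunLike.congr_fun hf (x n s)
    rw [h0, norm_zero, zero_mul]
    positivity
  · rw [norm_mul]
    gcongr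
    · exact f₁.norm_coe_le_norm _
    · exact f₂.norm_coe_le_norm _
    · exact h s t hst

/-- The points `g⁻¹ • x n t` and `x n (g⁻¹ • t)` may differ, but they lie in the same fibre of `π
n`. The oscillation `η` of `f` on fibres accounts for this, and `ε` for the approximate equivariance
of the elements. -/
theorem norm_sampleSeq_translate_le {G : Type u} [Group G] [MulAction G X]
    [ContinuousConstSMul G X] [∀ n, MulAction G (Q n)] {π : ∀ n, X → Q n}
    (hπG : ∀ n (g : G) a, π n (g • a) = g • π n a) (hx : ∀ n t, π n (x n t) = t)
    (β : A →⋆ₙₐ[ℂ] A) (g : G) (f : C(X, ℂ)) (n : ℕ) (u : A) {ε η : ℝ} (hη : 0 ≤ η)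
    (h : ∀ t, ‖(β (star (z n t) * z n t) - star (z n (g • t)) * z n (g • t)) * u‖ ≤ ε)
    (hf : ∀ a b, π n a = π n b → ‖f a - f b‖ ≤ η) :
    ‖(sampleSeq x z hz (translateFun g f) n - β (sampleSeq x z hz f n)) * u‖ ≤
      η * ‖u‖ + Fintype.card (Q n) * (‖f‖ * ε) := by
  have h1 : sampleSeq x z hz (translateFun g f) n
      = ∑ t, f (g⁻¹ • x n t) • (star (z n t) * z n t) := rfl
  have h2 : ∑ t, f (x n t) • (star (z n (g • t)) * z n (g • t))
      = ∑ t, f (x n (g⁻¹ • t)) • (star (z n t) * z n t) := by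
    rw [← Equiv.sum_comp (MulAction.toPerm g)
      fun t => f (x n (g⁻¹ • t)) • (star (z n t) * z n t)]
    simp
  have h3 : (sampleSeq x z hz (translateFun g f) n - β (sampleSeq x z hz f n)) * u
      = (∑ t, (f (g⁻¹ • x n t) - f (x n (g⁻¹ • t))) • (star (z n t) * z n t)) * u
        - ∑ t, f (x n t) •
          ((β (star (z n t) * z n t) - star (z n (g • t)) * z n (g • t)) * u) := by
    have h4 : ∑ t, (f (g⁻¹ • x n t) - f (x n (g⁻¹ • t))) • (star (z n t) * z n t)
        = ∑ t, f (g⁻¹ • x n t) • (star (z n t) * z n t)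
          - ∑ t, f (x n t) • (star (z n (g • t)) * z n (g • t)) := by
      rw [h2, ← Finset.sum_sub_distrib]
      exact Finset.sum_congr rfl fun t _ => sub_smul _ _ _
    have h5 : ∑ t, f (x n t) • ((β (star (z n t) * z n t) - star (z n (g • t)) * z n (g • t)) * u)
        = (∑ t, β (f (x n t) • (star (z n t) * z n t))
          - ∑ t, f (x n t) • (star (z n (g • t)) * z n (g • t))) * u := by
      rw [← Finset.sum_sub_distrib, Finset.sum_mul]
      refine Finset.sum_congr rfl fun t _ => ?_
      rw [map_smul, ← smul_sub, smul_mul_assoc]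
    rw [h1, sampleSeq_apply, map_sum, h4, h5, ← sub_mul]
    congr 1
    abel
  rw [h3]
  refine (norm_sub_le _ _).trans (add_le_add ?_ ?_)
  · refine (norm_mul_le _ _).trans ?_
    gcongr
    -- The oscillation is not controlled against the cardinality of `Q n`, so a termwise estimate
    -- would not be enough here.
    refine (norm_sum_smul_star_mul_self_le _ (z n) hη fun t => hf _ _ ?_).trans
      (mul_le_of_le_one_right hη (hz n))
    rw [hπG, hx, hx]
  · refine (norm_sum_le_of_le _ (n := fun _ => ‖f‖ * ε) fun t _ => ?_).trans (by simp)
    rw [norm_smul]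
    gcongr
    · exact f.norm_coe_le_norm _
    · exact h t

end SampleSeq

variable {G : Type u} [Group G] {α : G →* (A ≃⋆ₐ[ℂ] A)} {D : NonUnitalStarSubalgebra ℂ A}

/-- For each `n`, sampling is linear, positive and contractive in `f`, so these properties survive
in the limit. The other relations hold up to errors that tend to zero against each point of a dense
sequence of `D`, which is all that `F(D, A)` detects. -/
theorem exists_equivariantOrderZero_of_approx [MulAction G X] [ContinuousConstSMul G X]
    [∀ n, MulAction G (Q n)] {π : ∀ n, X → Q n} (hπ : IsProfinitePartition π)
    (hπG : ∀ n (g : G) a, π n (g • a) = g • π n a) (hD : IsInvariantSub α D)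
    {s : ℕ → D} (hs : DenseRange s) {L : Type*} [Fintype L] {U : ℕ → Finset A}
    {K : ℕ → Finset G} {ε : ℕ → ℝ} (hU : ∀ i n, i ≤ n → (s i : A) ∈ U n)
    (hK : ∀ g, ∀ᶠ n in Filter.atTop, g ∈ K n) (hε0 : ∀ n, 0 ≤ ε n)
    (hε : Filter.Tendsto (fun n => ((Fintype.card (Q n) : ℝ) + 1) ^ 2 * ε n) Filter.atTop (nhds 0))
    {y : ∀ n, L → Q n → A} (hy : ∀ n, IsApproxRokhlinFamily α (U n) (K n) (ε n) (y n)) :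
    ∃ φ : L → (C(X, ℂ) →CP CentralSeqAlg D),
      (∀ l, IsEquivariantOrderZeroCCP hD (φ l)) ∧ IsUnitOf (∑ l, φ l 1) := by
  choose x hx using hπ.surjective
  have hz : ∀ n l t, ∃ z, y n l t = star z * z := fun n => (hy n).exists_eq
  choose z hz using hz
  obtain rfl : y = fun n l t => star (z n l t) * z n l t := by
    funext n l t; exact hz n l t
  have hz1 : ∀ l n, ‖∑ t, star (z n l t) * z n l t‖ ≤ 1 := fun l n => (hy n).norm_sum_le l
  set S : L → C(X, ℂ) →ₗ[ℂ] BddSeq A := fun l => sampleSeq x (fun n => z n l) (hz1 l) with hS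
  have hdense : ∀ f g : A → SeqAlg A, Continuous f → Continuous g →
      (∀ i, f (s i) = g (s i)) → ∀ w ∈ D, f w = g w := by
    intro f g hf hg h w hw
    exact hs.induction_on (p := fun w : D => f w = g w) ⟨w, hw⟩
      (isClosed_eq (by fun_prop) (by fun_prop)) h
  have hcard : ∀ n, (0 : ℝ) ≤ Fintype.card (Q n) := fun n => Nat.cast_nonneg _
  -- The factor `(card + 1) ^ 2` dominates 1, `card` and `card ^ 2`, which are the factors in the
  -- unit, commutator or equivariance, and orthogonality estimates.
  have hε1 : Filter.Tendsto ε Filter.atTop (nhds 0) := by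
    refine squeeze_zero hε0 (fun n => ?_) hε
    nlinarith [hcard n, hε0 n, mul_nonneg (hcard n) (hε0 n),
      mul_nonneg (hcard n) (mul_nonneg (hcard n) (hε0 n))]
  have hε2 : Filter.Tendsto (fun n => Fintype.card (Q n) * ε n) Filter.atTop (nhds 0) := by
    refine squeeze_zero (fun n => mul_nonneg (hcard n) (hε0 n)) (fun n => ?_) hε
    nlinarith [hcard n, hε0 n, mul_nonneg (hcard n) (hε0 n),
      mul_nonneg (hcard n) (mul_nonneg (hcard n) (hε0 n))]
  have hε3 : Filter.Tendsto (fun n => Fintype.card (Q n) * (Fintype.card (Q n) * ε n))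
      Filter.atTop (nhds 0) := by
    refine squeeze_zero (fun n => mul_nonneg (hcard n) (mul_nonneg (hcard n) (hε0 n)))
      (fun n => ?_) hε
    nlinarith [hcard n, hε0 n, mul_nonneg (hcard n) (hε0 n),
      mul_nonneg (hcard n) (mul_nonneg (hcard n) (hε0 n))]
  have hmem : ∀ l f, (c0Ideal A).proj (S l f) ∈ relCommutant D := by
    intro l f
    refine hdense _ _ (by fun_prop) (by fun_prop) fun i => ?_
    rw [← sub_eq_zero]
    refine (SeqAlg.proj_eq_zero_iff
      (x := S l f * constSeq (s i : A) - constSeq (s i : A) * S l f)).mpr ?_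
    have hlim : Filter.Tendsto (fun n => Fintype.card (Q n) * (‖f‖ * ε n)) Filter.atTop
        (nhds 0) := by
      simpa [mul_left_comm] using hε2.const_mul ‖f‖
    refine squeeze_zero_norm' ?_ hlim
    filter_upwards [Filter.eventually_ge_atTop i] with n hn
    exact norm_sampleSeq_commutator_le x _ (hz1 l) f n (s i) fun t =>
      (hy n).comm l t _ (hU i n hn)
  let C : L → C(X, ℂ) →ₗ[ℂ] relCommutant D := fun l =>
    { toFun := fun f => ⟨(c0Ideal A).proj (S l f), hmem l f⟩
      map_add' := fun f g => Subtype.ext (by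
        change (c0Ideal A).proj (S l (f + g)) = (c0Ideal A).proj (S l f) + (c0Ideal A).proj (S l g)
        rw [map_add, map_add])
      map_smul' := fun c f => Subtype.ext (by
        change (c0Ideal A).proj (S l (c • f)) = c • (c0Ideal A).proj (S l f)
        rw [map_smul, map_smul]) }
  have hC : ∀ l f, (C l f : SeqAlg A) = (c0Ideal A).proj (S l f) := fun l f => rfl
  let Φ : L → C(X, ℂ) →ₗ[ℂ] CentralSeqAlg D := fun l => (annIdeal D).mkₗ.comp (C l)
  have hΦ : ∀ l f, Φ l f = (annIdeal D).proj (C l f) := fun l f => rfl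
  have hcontr : ∀ l f, ‖Φ l f‖ ≤ ‖f‖ := fun l f =>
    ((annIdeal D).norm_mkₗ_le _).trans (((c0Ideal A).norm_mkₗ_le _).trans
      (norm_sampleSeq_le x _ (hz1 l) f))
  have hpos : ∀ l f, 0 ≤ f → 0 ≤ Φ l f := by
    intro l f hf
    obtain ⟨w, hw⟩ := exists_proj_sampleSeq_eq x _ (hz1 l) hf
    exact proj_nonneg (C l f) hw
  -- With adjoints preserved, all four products in the definition of orthogonality reduce to
  -- preservation of zero products.
  have hstar : ∀ l f, Φ l (star f) = star (Φ l f) := by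
    intro l f
    rw [hΦ, hΦ, ← map_star]
    congr 1
    refine Subtype.ext ?_
    change (c0Ideal A).proj (S l (star f)) = star ((c0Ideal A).proj (S l f))
    rw [← map_star]
    congr 1
    exact sampleSeq_star x _ (hz1 l) f
  have hmul : ∀ l f₁ f₂, f₁ * f₂ = 0 → Φ l f₁ * Φ l f₂ = 0 := by
    intro l f₁ f₂ hf
    rw [hΦ, hΦ, ← map_mul]
    refine proj_eq_zero_of_mul_const (hdense _ (fun _ => 0) (by fun_prop) (by fun_prop) fun i => ?_)
    refine (SeqAlg.proj_eq_zero_iff (x := S l f₁ * S l f₂ * constSeq (s i : A))).mpr ?_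
    have hlim : Filter.Tendsto (fun n => Fintype.card (Q n) * (Fintype.card (Q n) *
        (‖f₁‖ * ‖f₂‖ * ε n))) Filter.atTop (nhds 0) := by
      simpa [mul_left_comm] using hε3.const_mul (‖f₁‖ * ‖f₂‖)
    refine squeeze_zero_norm' ?_ hlim
    filter_upwards [Filter.eventually_ge_atTop i] with n hn
    exact norm_sampleSeq_mul_le x _ (hz1 l) f₁ f₂ hf n (s i) (hε0 n) fun t t' htt' =>
      (hy n).mul l t t' htt' _ (hU i n hn)
  have hequi : ∀ l g f, Φ l (translateFun g f) = centralAction hD g (Φ l f) := by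
    intro l g f
    rw [← sub_eq_zero]
    change (annIdeal D).proj (C l (translateFun g f) - commutantAction hD g (C l f)) = 0
    refine proj_eq_zero_of_mul_const (hdense _ (fun _ => 0) (by fun_prop) (by fun_prop) fun i => ?_)
    refine (SeqAlg.proj_eq_zero_iff (x := (S l (translateFun g f) -
      BddSeq.map (α g : A →⋆ₙₐ[ℂ] A) (S l f)) * constSeq (s i : A))).mpr ?_
    have hlim : Filter.Tendsto (fun n => Fintype.card (Q n) * (‖f‖ * ε n)) Filter.atTop
        (nhds 0) := by
      simpa [mul_left_comm] using hε2.const_mul ‖f‖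
    rw [Metric.tendsto_nhds]
    intro r hr
    -- The oscillation bound is chosen so that its product with `‖s i‖` is at most `r / 2`; the
    -- cardinality term takes the other half.
    filter_upwards [Filter.eventually_ge_atTop i, hK g,
      hlim.eventually (gt_mem_nhds (half_pos hr)),
      hπ.eventually_norm_sub_lt f (show 0 < r / (2 * (‖(s i : A)‖ + 1)) by positivity)]
      with n hn hg h1 h2
    rw [dist_zero_right]
    refine (norm_sampleSeq_translate_le x _ (hz1 l) hπG hx (α g : A →⋆ₙₐ[ℂ] A) g f n (s i : A)
      (by positivity) (fun t => (hy n).equivariant l t g hg _ (hU i n hn))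
      fun a b hab => (h2 a b hab).le).trans_lt ?_
    have h3 : r / (2 * (‖(s i : A)‖ + 1)) * ‖(s i : A)‖ ≤ r / 2 := by
      rw [div_mul_eq_mul_div, div_le_div_iff₀ (by positivity) (by positivity)]
      nlinarith [norm_nonneg (s i : A)]
    linarith
  refine ⟨fun l => ⟨Φ l, hπ.map_cstarMatrix_nonneg (Φ l) (hpos l) (hcontr l)⟩, fun l =>
    ⟨hcontr l, fun f₁ f₂ h => ⟨hmul l _ _ h.1, hmul l _ _ h.2.1, ?_, ?_⟩, hequi l⟩, ?_⟩
  · change star (Φ l f₁) * Φ l f₂ = 0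
    rw [← hstar]
    exact hmul l _ _ h.2.2.1
  · change star (Φ l f₂) * Φ l f₁ = 0
    rw [← hstar]
    exact hmul l _ _ h.2.2.2
  · have h1 : ∑ l, Φ l 1 = (annIdeal D).proj (∑ l, C l 1) := by
      rw [map_sum]
      exact Finset.sum_congr rfl fun l _ => hΦ l 1
    change IsUnitOf (∑ l, Φ l 1)
    rw [h1]
    refine isUnitOf_of_mul_const_eq (hdense _ _ (by fun_prop) (by fun_prop) fun i => ?_)
    have h2 : ((∑ l, C l 1 : relCommutant D) : SeqAlg A) = (c0Ideal A).proj (∑ l, S l 1) := by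
      rw [AddSubmonoidClass.coe_finsetSum, map_sum]
      exact Finset.sum_congr rfl fun l _ => hC l 1
    rw [h2, ← sub_eq_zero]
    refine (SeqAlg.proj_eq_zero_iff
      (x := (∑ l, S l 1) * constSeq (s i : A) - constSeq (s i : A))).mpr ?_
    refine squeeze_zero_norm' ?_ hε1
    filter_upwards [Filter.eventually_ge_atTop i] with n hn
    have h3 : (∑ l, S l 1) n = ∑ l, ∑ t, star (z n l t) * z n l t := by
      rw [BddSeq.sum_apply]
      refine Finset.sum_congr rfl fun l _ => ?_
      rw [hS, sampleSeq_apply]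
      simp
    change ‖(∑ l, S l 1) n * (s i : A) - (s i : A)‖ ≤ ε n
    rw [h3]
    exact (hy n).unit _ (hU i n hn)

end Limit

/-! ### The finite quotients of the profinite completion -/

namespace ProfCompletion

variable {G : Type u} [Group G]

/-- The projection of the profinite completion onto a finite quotient of `G`. -/
noncomputable def toQuotient (N : FiniteIndexNormalSubgroup G) (x : ProfCompletion G) :
    G ⧸ N.toSubgroup := x.1 N

theorem isLocallyConstant_toQuotient (N : FiniteIndexNormalSubgroup G) :
    IsLocallyConstant (toQuotient N) := by
  have h : Continuous fun x : ProfCompletion G => x.1 N :=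
    (continuous_apply N).comp continuous_subtype_val
  have : DiscreteTopology ((ProfiniteGrp.ProfiniteCompletion.diagram (GrpCat.of G)).obj N) := ⟨rfl⟩
  intro s
  exact (isOpen_discrete
    (α := (ProfiniteGrp.ProfiniteCompletion.diagram (GrpCat.of G)).obj N) s).preimage h

theorem toQuotient_smul (N : FiniteIndexNormalSubgroup G) (g : G) (x : ProfCompletion G) :
    toQuotient N (g • x) = g • toQuotient N x := rfl

theorem toQuotient_surjective (N : FiniteIndexNormalSubgroup G) :
    Function.Surjective (toQuotient N) := by
  intro t
  obtain ⟨g, rfl⟩ := QuotientGroup.mk_surjective t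
  exact ⟨toProfCompletion G g, rfl⟩

theorem map_toQuotient {M N : FiniteIndexNormalSubgroup G} (h : M ≤ N) (x : ProfCompletion G) :
    QuotientGroup.map M.toSubgroup N.toSubgroup (MonoidHom.id G) h (toQuotient M x)
      = toQuotient N x :=
  x.2 (CategoryTheory.homOfLE h)

theorem toQuotient_eq_of_le {M N : FiniteIndexNormalSubgroup G} (h : M ≤ N)
    {x y : ProfCompletion G} (hxy : toQuotient M x = toQuotient M y) :
    toQuotient N x = toQuotient N y := by
  rw [← map_toQuotient h, hxy, map_toQuotient]

theorem ext_toQuotient {x y : ProfCompletion G} (h : ∀ N, toQuotient N x = toQuotient N y) :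
    x = y :=
  Subtype.ext (funext h)

end ProfCompletion

theorem Group.FG.countable (G : Type u) [Group G] [h : Group.FG G] : Countable G := by
  obtain ⟨α, _, φ, hφ⟩ := Group.fg_iff_exists_freeGroup_hom_surjective_finite.mp h
  exact hφ.countable

/-- A finitely generated group has countably many normal subgroups of finite index. -/
theorem countable_finiteIndexNormalSubgroup (G : Type u) [Group G] [Group.FG G] :
    Countable (FiniteIndexNormalSubgroup G) := by
  have := Group.FG.countable G
  -- Subgroups of finite index in a finitely generated group are finitely generated, so each is
  -- determined by a finite subset of the countable set `G`.
  have hfg : ∀ N : FiniteIndexNormalSubgroup G,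
      ∃ S : Finset G, Subgroup.closure (S : Set G) = N.toSubgroup := fun N =>
    (Group.fg_iff_subgroup_fg N.toSubgroup).mp inferInstance
  choose S hS using hfg
  have hinj : Function.Injective S := fun M N h =>
    FiniteIndexNormalSubgroup.toSubgroup_injective (show M.toSubgroup = N.toSubgroup by
      rw [← hS M, ← hS N, h])
  exact hinj.countable

/-- A finitely generated group has a decreasing sequence of normal subgroups of finite index that
is cofinal among them. -/
theorem exists_antitone_finiteIndexNormalSubgroup (G : Type u) [Group G] [Group.FG G] :
    ∃ N : ℕ → FiniteIndexNormalSubgroup G, (∀ n, N (n + 1) ≤ N n) ∧ ∀ M, ∃ n, N n ≤ M := by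
  have := countable_finiteIndexNormalSubgroup G
  have : Nonempty (FiniteIndexNormalSubgroup G) := ⟨FiniteIndexNormalSubgroup.ofSubgroup ⊤⟩
  obtain ⟨e, he⟩ := exists_surjective_nat (FiniteIndexNormalSubgroup G)
  -- The running intersections of an enumeration are decreasing, and the `n`th lies below `e n`.
  let N : ℕ → FiniteIndexNormalSubgroup G := fun n => Nat.rec (e 0) (fun k M => M ⊓ e (k + 1)) n
  refine ⟨N, fun n => inf_le_left, fun M => ?_⟩
  obtain ⟨n, rfl⟩ := he M
  refine ⟨n, ?_⟩
  cases n with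
  | zero => exact le_rfl
  | succ n => exact inf_le_right

/-! ### Comparison of Rokhlin maps -/

section Comparison

variable {G : Type u} [Group G] {A : Type v} [NonUnitalCStarAlgebra A] {α : G →* (A ≃⋆ₐ[ℂ] A)}
  {D : NonUnitalStarSubalgebra ℂ A}

/-- Rokhlin maps pull back along equivariant continuous maps. -/
theorem exists_equivariantOrderZero_comp {X Y : Type*} [TopologicalSpace X] [CompactSpace X]
    [MulAction G X] [ContinuousConstSMul G X] [TopologicalSpace Y] [CompactSpace Y]
    [MulAction G Y] [ContinuousConstSMul G Y] (p : C(X, Y)) (hp : ∀ (g : G) x, p (g • x) = g • p x)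
    {hD : IsInvariantSub α D} {φ : C(X, ℂ) →CP CentralSeqAlg D}
    (hφ : IsEquivariantOrderZeroCCP hD φ) :
    ∃ ψ : C(Y, ℂ) →CP CentralSeqAlg D, IsEquivariantOrderZeroCCP hD ψ ∧ ψ 1 = φ 1 := by
  let c : C(Y, ℂ) →⋆ₐ[ℂ] C(X, ℂ) := ContinuousMap.compStarAlgHom' ℂ ℂ p
  let ψ : C(Y, ℂ) →CP CentralSeqAlg D :=
    { toLinearMap := φ.toLinearMap.comp (c : C(Y, ℂ) →ₗ[ℂ] C(X, ℂ))
      map_cstarMatrix_nonneg' := fun k M hM =>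
        φ.map_cstarMatrix_nonneg' k (M.map c)
          (CompletelyPositiveMapClass.map_cstarMatrix_nonneg' c k M hM) }
  have hψ : ∀ f, ψ f = φ (f.comp p) := fun f => rfl
  refine ⟨ψ, ⟨fun f => ?_, fun f₁ f₂ h => ?_, fun g f => ?_⟩, rfl⟩
  · refine (hφ.contractive _).trans ((ContinuousMap.norm_le _ (norm_nonneg f)).mpr fun x => ?_)
    exact f.norm_coe_le_norm _
  · refine hφ.orderZero _ _ ⟨?_, ?_, ?_, ?_⟩
    · exact congrArg (fun f : C(Y, ℂ) => f.comp p) h.1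
    · exact congrArg (fun f : C(Y, ℂ) => f.comp p) h.2.1
    · exact congrArg (fun f : C(Y, ℂ) => f.comp p) h.2.2.1
    · exact congrArg (fun f : C(Y, ℂ) => f.comp p) h.2.2.2
  · rw [hψ, hψ, ← hφ.equivariant]
    congr 1
    ext x
    change f (g⁻¹ • p x) = f (p (g⁻¹ • x))
    rw [hp]

/-- Rokhlin maps on a finite discrete `G`-space give a Rokhlin family; the number of maps may be
enlarged. -/
theorem exists_isRokhlinFamily {Q : Type*} [TopologicalSpace Q] [DiscreteTopology Q] [Fintype Q]
    [MulAction G Q] [ContinuousConstSMul G Q] {hD : IsInvariantSub α D} {m d : ℕ} (hmd : m ≤ d)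
    {φ : Fin (m + 1) → (C(Q, ℂ) →CP CentralSeqAlg D)}
    (hφ : ∀ l, IsEquivariantOrderZeroCCP hD (φ l)) (h1 : IsUnitOf (∑ l, φ l 1)) :
    ∃ b : Fin (d + 1) → Q → CentralSeqAlg D, IsRokhlinFamily hD b := by
  classical
  let δ : Q → C(Q, ℂ) := fun t => ⟨fun s => if s = t then 1 else 0, continuous_of_discreteTopology⟩
  have hδ : ∀ t s, δ t s = if s = t then 1 else 0 := fun _ _ => rfl
  have hδ0 : ∀ t, 0 ≤ δ t := by
    intro t s
    change (0 : ℂ) ≤ if s = t then 1 else 0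
    split_ifs <;> simp
  have hδstar : ∀ t, star (δ t) = δ t := by
    intro t
    ext s
    change star (if s = t then (1 : ℂ) else 0) = if s = t then 1 else 0
    split_ifs <;> simp
  have hδmul : ∀ s t, s ≠ t → δ s * δ t = 0 := by
    intro s t hst
    ext r
    change (if r = s then (1 : ℂ) else 0) * (if r = t then (1 : ℂ) else 0) = 0
    by_cases h : r = s
    · subst h; simp [hst]
    · simp [h]
  have hδsum : ∑ t, δ t = 1 := by
    ext s
    rw [ContinuousMap.sum_apply]
    simp [hδ]
  have hδtr : ∀ (g : G) t, translateFun g (δ t) = δ (g • t) := by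
    intro g t
    ext s
    change (if g⁻¹ • s = t then (1 : ℂ) else 0) = if s = g • t then 1 else 0
    simp only [inv_smul_eq_iff]
  have hsum : ∀ l, ∑ t, φ l (δ t) = φ l 1 := fun l => by rw [← map_sum, hδsum]
  -- The family is padded with zeros beyond index `m`; they satisfy the relations and leave the
  -- total sum unchanged.
  let b : Fin (d + 1) → Q → CentralSeqAlg D := fun l t =>
    if h : (l : ℕ) < m + 1 then φ ⟨l, h⟩ (δ t) else 0
  have hb : ∀ (l : Fin (d + 1)) (h : (l : ℕ) < m + 1) t, b l t = φ ⟨l, h⟩ (δ t) :=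
    fun l h t => dif_pos h
  have hb' : ∀ (l : Fin (d + 1)) (_ : ¬ (l : ℕ) < m + 1) t, b l t = 0 :=
    fun l h t => dif_neg h
  refine ⟨b, fun l t => ?_, fun l s t hst => ?_, fun l => ?_, fun l g t => ?_, ?_⟩
  · by_cases h : (l : ℕ) < m + 1
    · rw [hb l h, ← map_zero (φ ⟨l, h⟩)]
      exact OrderHomClass.mono (φ ⟨l, h⟩) (hδ0 t)
    · rw [hb' l h]
  · by_cases h : (l : ℕ) < m + 1
    · rw [hb l h, hb l h]
      exact ((hφ _).orderZero _ _ ⟨hδmul s t hst, hδmul t s hst.symm,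
        by rw [hδstar]; exact hδmul s t hst, by rw [hδstar]; exact hδmul t s hst.symm⟩).1
    · rw [hb' l h, zero_mul]
  · by_cases h : (l : ℕ) < m + 1
    · simp only [hb l h, hsum]
      refine ((hφ _).contractive 1).trans ((ContinuousMap.norm_le _ zero_le_one).mpr fun t => ?_)
      simp
    · simp [hb' l h]
  · by_cases h : (l : ℕ) < m + 1
    · rw [hb l h, hb l h, ← (hφ _).equivariant, hδtr]
    · rw [hb' l h, hb' l h, map_zero]
  · have h2 : ∑ l, ∑ t, b l t = ∑ l, φ l 1 := by
      have h3 : ∀ l : Fin (d + 1), ∑ t, b l t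
          = if h : (l : ℕ) < m + 1 then φ ⟨l, h⟩ 1 else 0 := by
        intro l
        by_cases h : (l : ℕ) < m + 1
        · rw [dif_pos h, ← hsum]
          exact Finset.sum_congr rfl fun t _ => hb l h t
        · rw [dif_neg h]
          exact Finset.sum_eq_zero fun t _ => hb' l h t
      simp only [h3]
      rw [Fin.sum_univ_eq_sum_range (fun i => if h : i < m + 1 then φ ⟨i, h⟩ 1 else 0) (d + 1),
        ← Finset.sum_subset (Finset.range_subset_range.mpr (by omega : m + 1 ≤ d + 1))
          (fun i _ hi => dif_neg (by simpa using hi)),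
        ← Fin.sum_univ_eq_sum_range (fun i => if h : i < m + 1 then φ ⟨i, h⟩ 1 else 0) (m + 1)]
      exact Finset.sum_congr rfl fun l _ => dif_pos l.2
    rw [h2]
    exact h1

variable [TopologicalSpace G] [DiscreteTopology G]

theorem exists_hasRokhlinMaps_of_rokhlinDim_le {d : ℕ} (h : rokhlinDim α ≤ d) (H : Subgroup G)
    [hH : H.FiniteIndex] : ∃ m ≤ d, HasRokhlinMaps α H m := by
  have h1 : rokhlinDimRel α H ≤ d := (le_iSup₂ (f := fun (H : Subgroup G) (_ : H.FiniteIndex) =>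
    rokhlinDimRel α H) H hH).trans h
  -- A strict inequality is what yields a witness from the infimum, hence the passage to `d + 1`.
  have h2 : rokhlinDimRel α H < ((d + 1 : ℕ) : ℕ∞) :=
    h1.trans_lt (by exact_mod_cast Nat.lt_succ_self d)
  rw [rokhlinDimRel, iInf_lt_iff] at h2
  obtain ⟨m, hm⟩ := h2
  rw [iInf_lt_iff] at hm
  obtain ⟨hm1, hm2⟩ := hm
  exact ⟨m, Nat.lt_succ_iff.mp (by exact_mod_cast hm2), hm1⟩

end Comparison

theorem mainTheorem3 {G : Type u} [Group G] [TopologicalSpace G] [DiscreteTopology G]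
    [Group.FG G] [Group.ResiduallyFinite G] {A : Type v} [NonUnitalCStarAlgebra A]
    (α : G →* (A ≃⋆ₐ[ℂ] A)) (d : ℕ) :
    rokhlinDim α ≤ (d : ℕ∞) ↔
      ∀ (D : NonUnitalStarSubalgebra ℂ A) (hD : IsInvariantSub α D), IsClosed (D : Set A) →
        TopologicalSpace.IsSeparable (D : Set A) →
        ∃ φ : Fin (d + 1) → (C(ProfCompletion G, ℂ) →CP CentralSeqAlg D),
          (∀ l, IsEquivariantOrderZeroCCP hD (φ l)) ∧ IsUnitOf (∑ l, φ l 1) := by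
  classical
  constructor
  · intro hdim D hD hDc hsep
    have := Group.FG.countable G
    obtain ⟨N, hN, hNcof⟩ := exists_antitone_finiteIndexNormalSubgroup G
    have := fun n => Fintype.ofFinite (G ⧸ (N n).toSubgroup)
    have hfam : ∀ n, ∃ b : Fin (d + 1) → G ⧸ (N n).toSubgroup → CentralSeqAlg D,
        IsRokhlinFamily hD b := by
      intro n
      have : DiscreteTopology (G ⧸ (N n).toSubgroup) :=
        QuotientGroup.discreteTopology (isOpen_discrete _)
      obtain ⟨m, hmd, hm⟩ := exists_hasRokhlinMaps_of_rokhlinDim_le hdim (N n).toSubgroup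
      obtain ⟨φ, hφ, h1⟩ := hm D hD hDc hsep
      exact exists_isRokhlinFamily hmd hφ h1
    choose b hb using hfam
    have : TopologicalSpace.SeparableSpace D := hsep.separableSpace
    let s : ℕ → D := TopologicalSpace.denseSeq D
    obtain ⟨e, he⟩ := exists_surjective_nat G
    -- With this choice `(card + 1) ^ 2 * ε n` equals `1 / (n + 1)`.
    let ε : ℕ → ℝ := fun n =>
      1 / ((n : ℝ) + 1) / ((Fintype.card (G ⧸ (N n).toSubgroup) : ℝ) + 1) ^ 2
    have hε : ∀ n, 0 < ε n := fun n => by positivity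
    choose y hy using fun n => (hb n).exists_approx hDc hsep
      ((Finset.range (n + 1)).image fun i => (s i : A)) (by
        intro u hu
        obtain ⟨i, _, rfl⟩ := Finset.mem_image.mp hu
        exact (s i).2) ((Finset.range (n + 1)).image e) (hε n)
    refine exists_equivariantOrderZero_of_approx
      (π := fun n => ProfCompletion.toQuotient (N n)) ?_
      (fun n => ProfCompletion.toQuotient_smul (N n)) hD
      (TopologicalSpace.denseRange_denseSeq D) ?_ ?_ (fun n => (hε n).le) ?_ hy
    · refine ⟨fun n => ProfCompletion.isLocallyConstant_toQuotient _,
        fun n => ProfCompletion.toQuotient_surjective _,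
        fun n x y => ProfCompletion.toQuotient_eq_of_le (hN n), fun x y hxy => ?_⟩
      -- Cofinality of the sequence shows that its quotients alone separate points of the
      -- completion.
      refine ProfCompletion.ext_toQuotient fun M => ?_
      obtain ⟨n, hn⟩ := hNcof M
      exact ProfCompletion.toQuotient_eq_of_le hn (hxy n)
    · exact fun i n hin => Finset.mem_image_of_mem _ (Finset.mem_range.mpr (by omega))
    · intro g
      obtain ⟨i, rfl⟩ := he g
      filter_upwards [Filter.eventually_ge_atTop i] with n hn
      exact Finset.mem_image_of_mem _ (Finset.mem_range.mpr (by omega))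
    · refine (tendsto_one_div_add_atTop_nhds_zero_nat (𝕜 := ℝ)).congr fun n => ?_
      exact (mul_div_cancel₀ _ (by positivity)).symm
  · intro h
    refine iSup₂_le fun H hH => ?_
    refine iInf₂_le d ?_
    intro D hD hDc hsep
    obtain ⟨φ, hφ, h1⟩ := h D hD hDc hsep
    -- `H` need not be normal, but its normal core still has finite index, so its quotient is a
    -- coordinate of the completion and maps equivariantly onto `G ⧸ H`.
    let N : FiniteIndexNormalSubgroup G := FiniteIndexNormalSubgroup.ofSubgroup H.normalCore
    let q : G ⧸ N.toSubgroup → G ⧸ H := Subgroup.quotientMapOfLE H.normalCore_le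
    let p : C(ProfCompletion G, G ⧸ H) := ⟨fun x => q (ProfCompletion.toQuotient N x),
      ((ProfCompletion.isLocallyConstant_toQuotient N).comp q).continuous⟩
    have hp : ∀ (g : G) x, p (g • x) = g • p x := by
      intro g x
      change q (g • ProfCompletion.toQuotient N x) = g • q (ProfCompletion.toQuotient N x)
      obtain ⟨k, hk⟩ := QuotientGroup.mk_surjective (ProfCompletion.toQuotient N x)
      rw [← hk]
      rfl
    choose ψ hψ hψ1 using fun l => exists_equivariantOrderZero_comp p hp (hφ l)
    refine ⟨ψ, hψ, ?_⟩
    simpa only [hψ1] using h1
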